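/- Let $G=(V,E)$ be a finite connected simple graph with degrees $d_i$, and let $a<t_0<b$. For $t\in(a,b)$ let real parameters $J_{ij}(t)\ge 0$ ($ij\in E$) and $h_i(t)$ ($i\in V$), depending continuously on $t$, define an attractive binary model on $x\in\{\pm1\}^V$ with $\psi_{ij}(x_i,x_j)=e^{J_{ij}x_ix_j}$ and $\psi_i(x_i)=e^{h_ix_i}$. Positive messages $\mu_{i\to j}$ are parametrized by the ratios $\eta_{i\to j}=\mu_{i\to j}(+)/\mu_{i\to j}(-)$, and loopy belief propagation (LBP) with parallel updates, $\mu^{\rm new}_{i\to j}(x_j)\propto\sum_{x_i}\psi_{ij}(x_i,x_j)\psi_i(x_i)\prod_{k\in N_i\setminus j}\mu_{k\to i}(x_i)$, is then a map $\eta\mapsto T_t(\eta)$. The beliefs at a fixed point are $b_i(x_i)\propto\psi_i(x_i)\prod_{k\in N_i}\mu_{k\to i}(x_i)$ and $b_{ij}(x_i,x_j)\propto\psi_{ij}(x_i,x_j)\psi_i(x_i)\psi_j(x_j)\prod_{k\in N_i\setminus j}\mu_{k\to i}(x_i)\prod_{k\in N_j\setminus i}\mu_{k\to j}(x_j)$,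 normalized to sum to one. The Bethe free energy is $$F_t(\{m_i,\chi_{ij}\})=-\sum_{ij\in E}J_{ij}\chi_{ij}-\sum_{i\in V}h_im_i+\sum_{ij\in E}\sum_{x_i,x_j=\pm1}\xi\Big(\tfrac{1+m_ix_i+m_jx_j+\chi_{ij}x_ix_j}{4}\Big)+\sum_{i\in V}(1-d_i)\sum_{x_i=\pm1}\xi\Big(\tfrac{1+m_ix_i}{2}\Big),\qquad \xi(x)=x\log x,$$ on the domain $L(G)$ of all $\{m_i,\chi_{ij}\}\in\mathbb R^{V\sqcup E}$ such that $1+m_ix_i+m_jx_j+\chi_{ij}x_ix_j>0$ for all $ij\in E$ and $x_i,x_j=\pm1$. Let $\eta(t)$, $t\in(a,b)$, be a continuous family of positive LBP fixed points, $T_t(\eta(t))=\eta(t)$, and let $q(t)$ be the corresponding point, with coordinates $m_i=\mathbb E_{b_i}[x_i]$ and $\chi_{ij}=\mathbb E_{b_{ij}}[x_ix_j]$. Suppose that the fixed point loses stability as $t$ crosses $t_0$: for $t\in(a,t_0)$ all eigenvalues of the derivative $T_t'(\eta(t))$ satisfy $|\lambda|<1$, and for $t\in(t_0,b)$ some eigenvalue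 satisfies $|\lambda|>1$. Then $q(t)\in L(G)$ for all $t \in (a,b)$, and the corresponding local minimum of the Bethe free energy becomes a saddle point: for $t\in(a,t_0)$, $q(t)$ is a local minimum of $F_t$ and $\det\nabla^2F_t(q(t))>0$; for $t\in(t_0,b)$, $q(t)$ is a saddle point of $F_t$, i.e. a critical point that is neither a local minimum nor a local maximum. If moreover $J_{ij}(t_0)>0$ for all $ij\in E$, then $\det\nabla^2F_t(q(t))<0$ for all $t>t_0$ sufficiently close to $t_0$, so that the determinant changes sign at $t_0$. -/

import Mathlib

open Set Filter Topology

namespace BetheLBP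

variable {V : Type*} [Fintype V] [DecidableEq V] (G : SimpleGraph V) [DecidableRel G.Adj]

/-- The value `±1` of a binary variable: `true` stands for `+1`, `false` for `-1`. -/
def spin (x : Bool) : ℝ := if x then 1 else -1

/-- A representative directed edge of an undirected edge. Everything below that is defined through
it is symmetric in the two end points, so that the choice does not matter. -/
noncomputable def orient (e : G.edgeSet) : G.Dart :=
  ⟨Quot.out e.1, by
    rw [← SimpleGraph.mem_edgeSet]
    have h : (Sym2.mk (Quot.out e.1).1 (Quot.out e.1).2) = e.1 := Quot.out_eq e.1
    rw [h]
    exact e.2⟩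

/-- The undirected edge of a directed edge. -/
def undirected {G : SimpleGraph V} (d : G.Dart) : G.edgeSet := ⟨d.edge, d.edge_mem⟩

variable {G}

/-! ### Loopy belief propagation

The model has `ψ_ij(x_i, x_j) = exp (J_ij x_i x_j)` and `ψ_i(x_i) = exp (h_i x_i)`. The message
along a directed edge `e` is a positive function on `{±1}` up to scaling, and it is parametrized by
the ratio `η_e = μ_e(+) / μ_e(-)`. -/

/-- The compatibility function of the edge underlying the directed edge `d`. -/
noncomputable def psiPair (J : G.edgeSet → ℝ) (d : G.Dart) (x y : Bool) : ℝ :=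
  Real.exp (J (undirected d) * spin x * spin y)

/-- The local function of a vertex. -/
noncomputable def psiVertex (h : V → ℝ) (i : V) (x : Bool) : ℝ :=
  Real.exp (h i * spin x)

/-- The message, up to scaling, with ratio `η_e`. -/
def message (η : G.Dart → ℝ) (e : G.Dart) (x : Bool) : ℝ := if x then η e else 1

/-- For `d = (i → j)`: the product `ψ_i(x_i) ∏_{k ∈ N_i \ j} μ_{k → i}(x_i)`. -/
noncomputable def cavity (h : V → ℝ) (η : G.Dart → ℝ) (d : G.Dart) (x : Bool) : ℝ :=
  psiVertex h d.fst x *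
    ∏ c ∈ Finset.univ.filter (fun c : G.Dart => c.snd = d.fst ∧ c.fst ≠ d.snd), message η c x

/-- The right-hand side of the update rule: for `d = (i → j)`, the sum over `x_i` of
`ψ_{ji}(x_j, x_i) ψ_i(x_i) ∏_{k ∈ N_i \ j} μ_{k → i}(x_i)`. -/
noncomputable def updatedMessage (J : G.edgeSet → ℝ) (h : V → ℝ) (η : G.Dart → ℝ)
    (d : G.Dart) (y : Bool) : ℝ :=
  ∑ x : Bool, psiPair J d x y * cavity h η d x

/-- The parallel update of loopy belief propagation, in terms of message ratios. -/
noncomputable def lbp (J : G.edgeSet → ℝ) (h : V → ℝ) (η : G.Dart → ℝ) : G.Dart → ℝ :=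
  fun d => updatedMessage J h η d true / updatedMessage J h η d false

/-- A fixed point of loopy belief propagation (messages are positive). -/
def IsLBPFixedPoint (J : G.edgeSet → ℝ) (h : V → ℝ) (η : G.Dart → ℝ) : Prop :=
  (∀ e, 0 < η e) ∧ lbp J h η = η

/-- The matrix of the linearization `T'(η)` of the update, regarded as a complex matrix. -/
noncomputable def lbpLinearization (J : G.edgeSet → ℝ) (h : V → ℝ) (η : G.Dart → ℝ) :
    Matrix G.Dart G.Dart ℂ :=
  (LinearMap.toMatrix' (fderiv ℝ (lbp J h) η : (G.Dart → ℝ) →ₗ[ℝ] (G.Dart → ℝ))).map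
    Complex.ofReal

/-- Local (linear) stability: all eigenvalues of `T'(η)` lie in the open unit disc. -/
def IsStable (J : G.edgeSet → ℝ) (h : V → ℝ) (η : G.Dart → ℝ) : Prop :=
  ∀ z ∈ spectrum ℂ (lbpLinearization J h η), ‖z‖ < 1

/-- (Linear) instability: some eigenvalue of `T'(η)` lies outside the closed unit disc. -/
def IsUnstable (J : G.edgeSet → ℝ) (h : V → ℝ) (η : G.Dart → ℝ) : Prop :=
  ∃ z ∈ spectrum ℂ (lbpLinearization J h η), 1 < ‖z‖

/-! ### Beliefs -/

/-- The unnormalized belief of a vertex: `ψ_i(x_i) ∏_{k ∈ N_i} μ_{k → i}(x_i)`. -/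
noncomputable def vertexWeight (h : V → ℝ) (η : G.Dart → ℝ) (i : V) (x : Bool) : ℝ :=
  psiVertex h i x * ∏ c ∈ Finset.univ.filter (fun c : G.Dart => c.snd = i), message η c x

/-- The unnormalized belief of the edge underlying `d = (i → j)`, at `(x_i, x_j) = (x, y)`. -/
noncomputable def pairWeight (J : G.edgeSet → ℝ) (h : V → ℝ) (η : G.Dart → ℝ)
    (d : G.Dart) (x y : Bool) : ℝ :=
  psiPair J d x y * cavity h η d x * cavity h η d.symm y

/-- The belief `b_i(x_i)`. -/
noncomputable def vertexBelief (h : V → ℝ) (η : G.Dart → ℝ) (i : V) (x : Bool) : ℝ :=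
  vertexWeight h η i x / ∑ x' : Bool, vertexWeight h η i x'

/-- The belief `b_ij(x_i, x_j)`. -/
noncomputable def pairBelief (J : G.edgeSet → ℝ) (h : V → ℝ) (η : G.Dart → ℝ)
    (d : G.Dart) (x y : Bool) : ℝ :=
  pairWeight J h η d x y / ∑ x' : Bool, ∑ y' : Bool, pairWeight J h η d x' y'

/-- The means `m_i = E_{b_i}[x_i]` and correlations `χ_ij = E_{b_ij}[x_i x_j]` of the beliefs. -/
noncomputable def beliefPoint (J : G.edgeSet → ℝ) (h : V → ℝ) (η : G.Dart → ℝ) :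
    V ⊕ G.edgeSet → ℝ
  | Sum.inl i => ∑ x : Bool, vertexBelief h η i x * spin x
  | Sum.inr e => ∑ x : Bool, ∑ y : Bool, pairBelief J h η (orient G e) x y * (spin x * spin y)

/-! ### The Bethe free energy, as a function of the means and correlations -/

/-- `1 + m_i x_i + m_j x_j + χ_ij x_i x_j` for the edge `e = ij`. -/
noncomputable def edgeForm (q : V ⊕ G.edgeSet → ℝ) (e : G.edgeSet) (x y : Bool) : ℝ :=
  1 + q (Sum.inl (orient G e).fst) * spin x + q (Sum.inl (orient G e).snd) * spin y
    + q (Sum.inr e) * (spin x * spin y)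

variable (G) in
/-- The domain `L(G)` of the Bethe free energy. -/
def betheDomain : Set (V ⊕ G.edgeSet → ℝ) :=
  {q | ∀ (e : G.edgeSet) (x y : Bool), 0 < edgeForm q e x y}

/-- The function `x log x`. -/
noncomputable def xlogx (x : ℝ) : ℝ := x * Real.log x

/-- The Bethe free energy. -/
noncomputable def betheFreeEnergy (J : G.edgeSet → ℝ) (h : V → ℝ) (q : V ⊕ G.edgeSet → ℝ) : ℝ :=
  - (∑ e : G.edgeSet, J e * q (Sum.inr e)) - ∑ i : V, h i * q (Sum.inl i)
    + ∑ e : G.edgeSet, ∑ x : Bool, ∑ y : Bool, xlogx (edgeForm q e x y / 4)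
    + ∑ i : V, (1 - (G.degree i : ℝ)) * ∑ x : Bool, xlogx ((1 + q (Sum.inl i) * spin x) / 2)

/-- The Hessian matrix of the Bethe free energy. -/
noncomputable def betheHessian (J : G.edgeSet → ℝ) (h : V → ℝ) (q : V ⊕ G.edgeSet → ℝ) :
    Matrix (V ⊕ G.edgeSet) (V ⊕ G.edgeSet) ℝ :=
  Matrix.of fun a b =>
    fderiv ℝ (fderiv ℝ (betheFreeEnergy J h)) q (Pi.single a 1) (Pi.single b 1)

/-- A saddle point: a critical point that is neither a local minimum nor a local maximum. -/
def IsSaddlePoint {E : Type*} [NormedAddCommGroup E] [NormedSpace ℝ E] (F : E → ℝ) (q : E) :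
    Prop :=
  HasFDerivAt F (0 : E →L[ℝ] ℝ) q ∧ ¬ IsLocalMin F q ∧ ¬ IsLocalMax F q

end BetheLBP

/-! The linearized update and the Hessian are tied together by a matrix `Y` indexed by the vertices
alone. In logarithms of the message ratios, `T'` at a fixed point becomes the non-backtracking
matrix `M` with weights `u d = Cov(x_i, x_j) / Var(x_j)` (`spectrum_lbpLinearization`);
attractiveness makes `M` entrywise nonnegative. On the other side, completing the square in the
correlations splits the Hessian form into positive squares plus the form of `Y = reducedHessian`
(`IsAttractivePoint.dotProduct_explicitHessian`), so both forms are positive definite, or take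
negative values, together. `Y` has nonpositive off-diagonal entries, i.e. it is a symmetric
Z-matrix.

The bridge is the identity `w = M w + u · (Y f)(tail)` for the flow `w` of a vertex vector `f`
(`flow_eq_sum_preds`). If the spectrum of `M` lies in the open disc, then `w = M w + u` has a
nonnegative solution; it is the flow of a positive `f` with `Y f = 1`, and a Z-matrix with such a
vector is positive definite (`posDef_of_spectrum`). Conversely, if `Y` is positive semidefinite,
some positive `f` has `Y f ≥ 0`; its flow is a nonnegative supersolution `M w ≤ w`, positive on the
support of every eigenvector with nonzero eigenvalue, and comparison with it bounds the eigenvalues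
by `1` (`norm_le_one_of_mem_spectrum`). Hence stability gives a positive definite Hessian, and
instability gives a direction of negative curvature. Fixed points are critical
(`entropySumGrad_eq_zero`), so second-order Taylor expansion yields the local minimum and the
saddle.

For the sign of the determinant, the Hessian at `t₀` is positive semidefinite as a limit from the
left. When all couplings are positive, a Perron–Frobenius argument on the connected graph shows that
a kernel vector vanishing at one vertex is zero. Adding the rank-one matrix of a vertex therefore
makes the Hessian positive definite at `t₀` and nearby. For `t > t₀` a negative direction exists,
and removing a rank-one term can create only one negative eigenvalue, so the determinant is
negative. -/

namespace BetheLBP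

/-! ### Real quadratic forms and rank-one perturbations. -/

section Quadratic

open Matrix

variable {n : Type*} [Fintype n]

lemma dotProduct_mulVec_eq_sum (A : Matrix n n ℝ) (x y : n → ℝ) :
    x ⬝ᵥ A *ᵥ y = ∑ i, ∑ j, A i j * (x i * y j) := by
  simp only [dotProduct, mulVec, Finset.mul_sum]
  exact Finset.sum_congr rfl fun i _ => Finset.sum_congr rfl fun j _ => by ring

lemma dotProduct_mulVec_comm_of_isSymm {A : Matrix n n ℝ} (hA : A.IsSymm) (x y : n → ℝ) :
    x ⬝ᵥ A *ᵥ y = y ⬝ᵥ A *ᵥ x := by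
  rw [dotProduct_mulVec, ← mulVec_transpose, hA.eq, dotProduct_comm]

lemma posDef_of_isSymm {A : Matrix n n ℝ} (hA : A.IsSymm)
    (h : ∀ x, x ≠ 0 → 0 < x ⬝ᵥ A *ᵥ x) : A.PosDef := by
  refine PosDef.of_dotProduct_mulVec_pos ?_ fun x hx => by simpa using h x hx
  rw [IsHermitian, conjTranspose_eq_transpose_of_trivial, hA.eq]

lemma PosDef.pos_of_ne_zero {A : Matrix n n ℝ} (hA : A.PosDef) {x : n → ℝ} (hx : x ≠ 0) :
    0 < x ⬝ᵥ A *ᵥ x := by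
  simpa using hA.dotProduct_mulVec_pos hx

lemma mulVec_eq_zero_of_nonneg {A : Matrix n n ℝ} (hA : A.IsSymm)
    (h : ∀ x, 0 ≤ x ⬝ᵥ A *ᵥ x) {x : n → ℝ} (hx : x ⬝ᵥ A *ᵥ x = 0) : A *ᵥ x = 0 := by
  have hp : A.PosSemidef := by
    refine PosSemidef.of_dotProduct_mulVec_nonneg ?_ fun x => by simpa using h x
    rw [IsHermitian, conjTranspose_eq_transpose_of_trivial, hA.eq]
  exact (hp.dotProduct_mulVec_zero_iff x).1 (by simpa using hx)

/-- A rank-one perturbation argument: a symmetric matrix that is not positive semidefinite, but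
becomes positive definite after adding `e eᵀ`, has negative determinant. -/
lemma det_neg_of_posDef_add_vecMulVec [DecidableEq n] {A : Matrix n n ℝ} {e : n → ℝ}
    (hP : (A + vecMulVec e e).PosDef) {x : n → ℝ} (hx : x ⬝ᵥ A *ᵥ x < 0) : A.det < 0 := by
  set P := A + vecMulVec e e with hPdef
  have hdet := hP.det_pos
  have hu : IsUnit P.det := isUnit_iff_ne_zero.2 hdet.ne'
  have hsymm : P.IsSymm := by
    have := hP.isHermitian
    rwa [IsHermitian, conjTranspose_eq_transpose_of_trivial] at this
  set y := P⁻¹ *ᵥ e with hy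
  have hPy : P *ᵥ y = e := by rw [hy, mulVec_mulVec, mul_nonsing_inv _ hu, one_mulVec]
  -- The matrix determinant lemma for `A = P - e eᵀ`, with `y = P⁻¹ e`.
  have hformula : A.det = P.det * (1 - e ⬝ᵥ y) := by
    have h1 := det_add_replicateCol_mul_replicateRow (ι := Unit) hu (-e) e
    have h2 : P + replicateCol Unit (-e) * replicateRow Unit e = A := by
      ext i j
      simp [hPdef, mul_apply, vecMulVec_apply]
    rw [h2] at h1
    rw [h1, det_unique (n := Unit)]
    congr 1
    have h3 : (replicateRow Unit e * P⁻¹ * replicateCol Unit (-e)) default default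
        = - (e ⬝ᵥ y) := by
      rw [Matrix.mul_assoc, hy, ← dotProduct_neg, ← mulVec_neg]
      rfl
    rw [Matrix.add_apply, h3, one_apply_eq]
    ring
  -- With `s = e · x`, nonnegativity of `P` at `x - s y` reads `x · A x ≥ s² (1 - e · y)`, which
  -- contradicts `x · A x < 0` if `e · y ≤ 1`.
  have hkey : 1 < e ⬝ᵥ y := by
    by_contra! hle
    set s := e ⬝ᵥ x with hs
    have h0 : 0 ≤ (x - s • y) ⬝ᵥ P *ᵥ (x - s • y) := by
      simpa using hP.posSemidef.dotProduct_mulVec_nonneg (x - s • y)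
    have h1 : (x - s • y) ⬝ᵥ P *ᵥ (x - s • y) = x ⬝ᵥ P *ᵥ x - 2 * s ^ 2 + s ^ 2 * (e ⬝ᵥ y) := by
      have h2 : y ⬝ᵥ P *ᵥ x = s := by
        rw [dotProduct_mulVec_comm_of_isSymm hsymm, hPy, dotProduct_comm]
      simp only [mulVec_sub, mulVec_smul, hPy, sub_dotProduct, dotProduct_sub, smul_dotProduct,
        dotProduct_smul, smul_eq_mul, h2]
      rw [dotProduct_comm x e, dotProduct_comm y e]
      ring
    have h2 : x ⬝ᵥ P *ᵥ x = x ⬝ᵥ A *ᵥ x + s ^ 2 := by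
      rw [hPdef, add_mulVec, dotProduct_add, vecMulVec_mulVec]
      simp [dotProduct_comm x e, ← hs, pow_two]
    nlinarith [sq_nonneg s]
  rw [hformula]
  exact mul_neg_of_pos_of_neg hdet (by linarith)

/-- Positive definiteness is an open condition. -/
lemma eventually_posDef {α : Type*} {l : Filter α} {A : α → Matrix n n ℝ} {A₀ : Matrix n n ℝ}
    (hA : ∀ t, (A t).IsSymm) (h₀ : A₀.PosDef) (hlim : Tendsto A l (𝓝 A₀)) :
    ∀ᶠ t in l, (A t).PosDef := by
  have hcont : Continuous fun p : Matrix n n ℝ × (n → ℝ) => p.2 ⬝ᵥ p.1 *ᵥ p.2 := by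
    fun_prop
  have hsphere : IsCompact (Metric.sphere (0 : n → ℝ) 1) := isCompact_sphere 0 1
  -- Compactness of the unit sphere makes the neighbourhood of `A₀` uniform in `x`; homogeneity then
  -- handles all vectors.
  have hopen : ∀ᶠ B in 𝓝 A₀, ∀ x ∈ Metric.sphere (0 : n → ℝ) 1, 0 < x ⬝ᵥ B *ᵥ x := by
    apply hsphere.eventually_forall_of_forall_eventually
    intro x hx
    have hx0 : x ≠ 0 := by
      rintro rfl
      simp at hx
    exact (hcont.tendsto (A₀, x)).eventually (lt_mem_nhds (PosDef.pos_of_ne_zero h₀ hx0))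
  filter_upwards [hlim.eventually hopen] with t ht
  refine posDef_of_isSymm (hA t) fun x hx => ?_
  have hn : 0 < ‖x‖ := norm_pos_iff.2 hx
  have h1 := ht (‖x‖⁻¹ • x) (by simp [norm_smul, hn.ne'])
  rw [mulVec_smul, smul_dotProduct, dotProduct_smul, smul_eq_mul, smul_eq_mul] at h1
  have h2 : x ⬝ᵥ A t *ᵥ x = ‖x‖ ^ 2 * (‖x‖⁻¹ * (‖x‖⁻¹ * (x ⬝ᵥ A t *ᵥ x))) := by
    field_simp
  rw [h2]
  positivity

end Quadratic

/-! ### Symmetric Z-matrices: Perron–Frobenius type facts. -/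

section ZMatrix

open Matrix

variable {n : Type*} [Fintype n] {A : Matrix n n ℝ}

/-- Diagonal terms do not change, and nonpositive off-diagonal entries turn `x i * x j ≤ |x i| * |x
j|` into the reverse inequality. -/
lemma abs_dotProduct_mulVec_abs_le (hoff : ∀ i j, i ≠ j → A i j ≤ 0) (x : n → ℝ) :
    (fun i => |x i|) ⬝ᵥ A *ᵥ (fun i => |x i|) ≤ x ⬝ᵥ A *ᵥ x := by
  rw [dotProduct_mulVec_eq_sum, dotProduct_mulVec_eq_sum]
  refine Finset.sum_le_sum fun i _ => Finset.sum_le_sum fun j _ => ?_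
  rcases eq_or_ne i j with rfl | hij
  · rw [abs_mul_abs_self]
  · refine mul_le_mul_of_nonpos_left ?_ (hoff i j hij)
    rw [← abs_mul]
    exact le_abs_self _

/-- The kernel of a positive semidefinite Z-matrix is closed under absolute values. -/
lemma mulVec_abs_eq_zero (hA : A.IsSymm) (hoff : ∀ i j, i ≠ j → A i j ≤ 0)
    (h : ∀ x, 0 ≤ x ⬝ᵥ A *ᵥ x) {x : n → ℝ} (hx : x ⬝ᵥ A *ᵥ x = 0) :
    A *ᵥ (fun i => |x i|) = 0 :=
  mulVec_eq_zero_of_nonneg hA h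
    (le_antisymm ((abs_dotProduct_mulVec_abs_le hoff x).trans hx.le) (h _))

/-- If `A v = 0` with `v ≥ 0`, then `v` cannot vanish at a vertex coupled to its support. -/
lemma apply_mul_eq_zero_of_mulVec_eq_zero (hoff : ∀ i j, i ≠ j → A i j ≤ 0) {v : n → ℝ}
    (hv : ∀ i, 0 ≤ v i) (hker : A *ᵥ v = 0) {i : n} (hi : v i = 0) (j : n) :
    A i j * v j = 0 := by
  have h0 : ∑ j, A i j * v j = 0 := congrFun hker i
  have hnp : ∀ j ∈ Finset.univ, A i j * v j ≤ 0 := by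
    intro j _
    rcases eq_or_ne i j with rfl | hij
    · simp [hi]
    · exact mul_nonpos_of_nonpos_of_nonneg (hoff i j hij) (hv j)
  exact (Finset.sum_eq_zero_iff_of_nonpos hnp).1 h0 j (Finset.mem_univ j)

/-- Positive definite Z-matrices are inverse nonnegative. -/
lemma nonneg_of_mulVec_nonneg (hoff : ∀ i j, i ≠ j → A i j ≤ 0) (hpos : A.PosDef)
    {f : n → ℝ} (hf : ∀ i, 0 ≤ (A *ᵥ f) i) (i : n) : 0 ≤ f i := by
  -- `g` is the negative part of `f` and `f + g` the positive part. Their supports are disjoint, so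
  -- only off-diagonal entries couple them and `g · A (f + g) ≤ 0`; together with `g · A f ≥ 0` this
  -- gives `g · A g ≤ 0`.
  set g : n → ℝ := fun i => max (-f i) 0 with hg
  have hg0 : ∀ i, 0 ≤ g i := fun i => le_max_right _ _
  have h1 : 0 ≤ g ⬝ᵥ A *ᵥ f := Finset.sum_nonneg fun i _ => mul_nonneg (hg0 i) (hf i)
  have h2 : g ⬝ᵥ A *ᵥ (f + g) ≤ 0 := by
    rw [dotProduct_mulVec_eq_sum]
    refine Finset.sum_nonpos fun i _ => Finset.sum_nonpos fun j _ => ?_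
    have hfg : ∀ j, 0 ≤ f j + g j := fun j => by
      have := le_max_left (-f j) 0
      simp only [hg]
      linarith
    rcases eq_or_ne i j with rfl | hij
    · have : g i * (f + g) i = 0 := by
        simp only [hg, Pi.add_apply]
        rcases le_total (-f i) 0 with h | h
        · simp [max_eq_right h]
        · simp [max_eq_left h]
      rw [this, mul_zero]
    · exact mul_nonpos_of_nonpos_of_nonneg (hoff i j hij) (mul_nonneg (hg0 i) (hfg j))
  rw [mulVec_add, dotProduct_add] at h2
  have hgz : g = 0 := by
    by_contra hne
    linarith [PosDef.pos_of_ne_zero hpos hne]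
  have := congrFun hgz i
  simp only [hg, Pi.zero_apply] at this
  linarith [le_max_left (-f i) 0]

/-- A symmetric Z-matrix that maps some positive vector to a positive vector is positive
definite. -/
lemma posDef_of_mulVec_pos (hA : A.IsSymm) (hoff : ∀ i j, i ≠ j → A i j ≤ 0) {f : n → ℝ}
    (hf : ∀ i, 0 < f i) (hAf : ∀ i, 0 < (A *ᵥ f) i) : A.PosDef := by
  refine posDef_of_isSymm hA fun x hx => ?_
  -- Ground state substitution: symmetrize the left side in `i` and `j`, then apply the
  -- arithmetic–geometric mean inequality to each pair, weighted by `A i j ≤ 0`.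
  have hlow : ∑ i, (A *ᵥ f) i * (x i ^ 2 / f i) ≤ x ⬝ᵥ A *ᵥ x := by
    have hexp : ∑ i, (A *ᵥ f) i * (x i ^ 2 / f i) = ∑ i, ∑ j, A i j * (f j * (x i ^ 2 / f i)) := by
      refine Finset.sum_congr rfl fun i _ => ?_
      simp only [mulVec, dotProduct, Finset.sum_mul, mul_assoc]
    have hexp' : ∑ i, ∑ j, A i j * (f j * (x i ^ 2 / f i))
        = ∑ i, ∑ j, A i j * (f i * (x j ^ 2 / f j)) := by
      rw [Finset.sum_comm]
      refine Finset.sum_congr rfl fun i _ => Finset.sum_congr rfl fun j _ => ?_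
      rw [hA.apply]
    have hterm : ∑ i, ∑ j, A i j * (f j * (x i ^ 2 / f i))
        + ∑ i, ∑ j, A i j * (f i * (x j ^ 2 / f j)) ≤ 2 * ∑ i, ∑ j, A i j * (x i * x j) := by
      rw [← Finset.sum_add_distrib, Finset.mul_sum]
      refine Finset.sum_le_sum fun i _ => ?_
      rw [← Finset.sum_add_distrib, Finset.mul_sum]
      refine Finset.sum_le_sum fun j _ => ?_
      have hfi := hf i
      have hfj := hf j
      rcases eq_or_ne i j with rfl | hij
      · apply le_of_eq
        field_simp
        ring
      · have h1 : 2 * (x i * x j) ≤ f j * (x i ^ 2 / f i) + f i * (x j ^ 2 / f j) := by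
          have h2 : f j * (x i ^ 2 / f i) + f i * (x j ^ 2 / f j) - 2 * (x i * x j)
              = (f j * x i - f i * x j) ^ 2 / (f i * f j) := by
            field_simp
            ring
          have h3 : 0 ≤ (f j * x i - f i * x j) ^ 2 / (f i * f j) := by positivity
          linarith
        have := mul_le_mul_of_nonpos_left h1 (hoff i j hij)
        linarith
    rw [dotProduct_mulVec_eq_sum, hexp]
    linarith
  refine lt_of_lt_of_le ?_ hlow
  obtain ⟨i, hi⟩ : ∃ i, x i ≠ 0 := by
    by_contra! hall
    exact hx (funext hall)
  refine Finset.sum_pos' (fun j _ => ?_) ⟨i, Finset.mem_univ i, ?_⟩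
  · have := hAf j
    have := hf j
    positivity
  · have := hAf i
    have := hf i
    positivity

/-- A positive semidefinite symmetric Z-matrix maps some positive vector to a nonnegative one. -/
lemma exists_pos_mulVec_nonneg [DecidableEq n] (hA : A.IsSymm)
    (hoff : ∀ i j, i ≠ j → A i j ≤ 0) (h : ∀ x, 0 ≤ x ⬝ᵥ A *ᵥ x) :
    ∃ f : n → ℝ, (∀ i, 0 < f i) ∧ ∀ i, 0 ≤ (A *ᵥ f) i := by
  -- a nonnegative kernel vector of maximal support
  obtain ⟨v, hv0, hvker, hvmax⟩ : ∃ v : n → ℝ, (∀ i, 0 ≤ v i) ∧ A *ᵥ v = 0 ∧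
      ∀ u : n → ℝ, A *ᵥ u = 0 → ∀ i, v i = 0 → u i = 0 := by
    have hch : ∀ i, ∃ u : n → ℝ, A *ᵥ u = 0 ∧ ((∃ u', A *ᵥ u' = 0 ∧ u' i ≠ 0) → u i ≠ 0) := by
      intro i
      by_cases hi : ∃ u', A *ᵥ u' = 0 ∧ u' i ≠ 0
      · obtain ⟨u', h1, h2⟩ := hi
        exact ⟨u', h1, fun _ => h2⟩
      · exact ⟨0, by simp, fun h => absurd h hi⟩
    choose u hu hu' using hch
    -- For each coordinate `k`, `u k` is a kernel vector nonzero at `k` whenever one exists;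
    -- absolute values prevent cancellation in the sum.
    refine ⟨∑ k, fun i => |u k i|, fun i => ?_, ?_, fun w hw i hi => ?_⟩
    · rw [Finset.sum_apply]
      exact Finset.sum_nonneg fun k _ => abs_nonneg _
    · rw [mulVec_sum]
      refine Finset.sum_eq_zero fun k _ => mulVec_abs_eq_zero hA hoff h ?_
      rw [hu k, dotProduct_zero]
    · by_contra hne
      rw [Finset.sum_apply, Finset.sum_eq_zero_iff_of_nonneg (fun k _ => abs_nonneg _)] at hi
      exact hu' i ⟨w, hw, hne⟩ (abs_eq_zero.1 (hi i (Finset.mem_univ i)))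
  -- Adding the indicator of the support of `v` removes the kernel, since every kernel vector is
  -- supported there. Rows outside the support are unaffected.
  set D : n → ℝ := fun i => if v i = 0 then 0 else 1 with hD
  have hDnn : ∀ i, 0 ≤ D i := fun i => by
    simp only [hD]
    split_ifs <;> norm_num
  have hquad : ∀ x : n → ℝ, x ⬝ᵥ (A + diagonal D) *ᵥ x = x ⬝ᵥ A *ᵥ x + ∑ i, D i * x i ^ 2 := by
    intro x
    rw [add_mulVec, dotProduct_add]
    congr 1
    refine Finset.sum_congr rfl fun i _ => ?_
    rw [mulVec_diagonal]
    ring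
  have hpos : (A + diagonal D).PosDef := by
    refine posDef_of_isSymm (hA.add (isSymm_diagonal D)) fun x hx => ?_
    rw [hquad]
    have hs : 0 ≤ ∑ i, D i * x i ^ 2 :=
      Finset.sum_nonneg fun i _ => mul_nonneg (hDnn i) (sq_nonneg _)
    refine lt_of_le_of_ne (add_nonneg (h x) hs) fun heq => hx ?_
    have hz : x ⬝ᵥ A *ᵥ x = 0 := by linarith [h x]
    have hz' : ∑ i, D i * x i ^ 2 = 0 := by linarith [h x]
    have hker := mulVec_eq_zero_of_nonneg hA h hz
    funext i
    by_cases hi : v i = 0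
    · exact hvmax x hker i hi
    · have := (Finset.sum_eq_zero_iff_of_nonneg
        (fun i _ => mul_nonneg (hDnn i) (sq_nonneg (x i)))).1 hz' i (Finset.mem_univ i)
      simpa [hD, hi] using this
  have hoff' : ∀ i j, i ≠ j → (A + diagonal D) i j ≤ 0 := fun i j hij => by
    simpa [diagonal_apply_ne _ hij] using hoff i j hij
  set g : n → ℝ := (A + diagonal D)⁻¹ *ᵥ 1 with hg
  have hgeq : (A + diagonal D) *ᵥ g = 1 := by
    rw [hg, mulVec_mulVec, mul_nonsing_inv _ (isUnit_iff_ne_zero.2 hpos.det_pos.ne'), one_mulVec]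
  have hgnn : ∀ i, 0 ≤ g i :=
    nonneg_of_mulVec_nonneg hoff' hpos fun i => by rw [hgeq]; exact zero_le_one
  have hgrow : ∀ i, v i = 0 → ∑ j, A i j * g j = 1 := by
    intro i hi
    have := congrFun hgeq i
    rw [add_mulVec, Pi.add_apply, mulVec_diagonal] at this
    simp only [hD, hi, if_true, zero_mul, add_zero] at this
    exact this
  -- `A` does not couple the support of `v` to its complement. Hence the glued vector has image `0`
  -- on the support, as `A v = 0`, and image at least `1` outside, where `A g = 1` and dropping `g`
  -- on the support cannot lower the value.
  refine ⟨fun i => if v i = 0 then g i else v i, fun i => ?_, fun i => ?_⟩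
  · by_cases hi : v i = 0
    · simp only [hi, if_true]
      refine lt_of_le_of_ne (hgnn i) fun h0 => ?_
      have h1 := hgrow i hi
      have h2 : ∑ j, A i j * g j ≤ 0 := Finset.sum_nonpos fun j _ => by
        rcases eq_or_ne i j with rfl | hij
        · simp [← h0]
        · exact mul_nonpos_of_nonpos_of_nonneg (hoff i j hij) (hgnn j)
      linarith
    · simp only [hi, if_false]
      exact lt_of_le_of_ne (hv0 i) (Ne.symm hi)
  · change 0 ≤ ∑ j, A i j * _
    by_cases hi : v i = 0
    · have : ∑ j, A i j * g j ≤ ∑ j, A i j * (if v j = 0 then g j else v j) := by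
        refine Finset.sum_le_sum fun j _ => ?_
        by_cases hj : v j = 0
        · simp [hj]
        · simp only [hj, if_false]
          rw [apply_mul_eq_zero_of_mulVec_eq_zero hoff hv0 hvker hi j]
          exact mul_nonpos_of_nonpos_of_nonneg
            (hoff i j (by rintro rfl; exact hj hi)) (hgnn j)
      rw [hgrow i hi] at this
      linarith
    · have h0 : ∑ j, A i j * v j = 0 := congrFun hvker i
      refine h0.ge.trans (Finset.sum_le_sum fun j _ => ?_)
      by_cases hj : v j = 0
      · simp only [hj, if_true, mul_zero]
        have h1 := apply_mul_eq_zero_of_mulVec_eq_zero hoff hv0 hvker hj i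
        rw [hA.apply] at h1
        rw [(mul_eq_zero.1 h1).resolve_right hi, zero_mul]
      · simp [hj]

end ZMatrix

end BetheLBP

namespace BetheLBP

/-! ### Second-order conditions for local extrema. -/

section SecondOrder

variable {E : Type*} [NormedAddCommGroup E] [NormedSpace ℝ E] {F : E → ℝ} {F' : E → E →L[ℝ] ℝ}
  {B : E →L[ℝ] E →L[ℝ] ℝ} {q : E}

/-- The second-order Taylor expansion at a critical point. -/
lemma eventually_abs_sub_half_le (hF : ∀ᶠ x in 𝓝 q, HasFDerivAt F (F' x) x) (hq : F' q = 0)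
    (hF' : HasFDerivAt F' B q) (hB : ∀ u v, B u v = B v u) {ε : ℝ} (hε : 0 < ε) :
    ∀ᶠ x in 𝓝 q, |F x - F q - B (x - q) (x - q) / 2| ≤ ε * ‖x - q‖ ^ 2 := by
  have h1 : ∀ᶠ x in 𝓝 q, ‖F' x - B (x - q)‖ ≤ ε * ‖x - q‖ := by
    have := hF'.isLittleO.def hε
    simpa [hq] using this
  obtain ⟨δ, hδ, hball⟩ := Metric.eventually_nhds_iff_ball.1 (hF.and h1)
  filter_upwards [Metric.ball_mem_nhds q hδ] with x hx
  -- The derivative of `φ` is the linearization error of `F'`, at most `ε ‖x - q‖` on the closed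
  -- ball of radius `‖x - q‖`; the mean value inequality supplies the second factor.
  set φ : E → ℝ := fun y => F y - B (y - q) (y - q) / 2 with hφ
  have hder : ∀ y ∈ Metric.closedBall q ‖x - q‖,
      HasFDerivWithinAt φ (F' y - B (y - q)) (Metric.closedBall q ‖x - q‖) y := by
    intro y hy
    have hyδ : y ∈ Metric.ball q δ := by
      rw [Metric.mem_closedBall, ← dist_eq_norm] at hy
      exact lt_of_le_of_lt hy hx
    have h2 : HasFDerivAt (fun y => B (y - q) (y - q) / 2) (B (y - q)) y := by
      have hid : HasFDerivAt (fun y : E => y - q) (ContinuousLinearMap.id ℝ E) y :=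
        (hasFDerivAt_id y).sub_const q
      have h3 := ((B.hasFDerivAt.comp y hid).clm_apply hid).const_mul (1 / 2 : ℝ)
      have h4 : (fun y => B (y - q) (y - q) / 2) = fun y => 1 / 2 * B (y - q) (y - q) := by
        funext y
        ring
      rw [h4]
      refine h3.congr_fderiv ?_
      ext v
      simp [hB v y, hB v q]
      ring
    exact ((hball y hyδ).1.sub h2).hasFDerivWithinAt
  have hbound : ∀ y ∈ Metric.closedBall q ‖x - q‖, ‖F' y - B (y - q)‖ ≤ ε * ‖x - q‖ := by
    intro y hy
    rw [Metric.mem_closedBall] at hy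
    have hyδ : y ∈ Metric.ball q δ := by
      rw [← dist_eq_norm] at hy
      exact lt_of_le_of_lt hy hx
    refine (hball y hyδ).2.trans ?_
    rw [← dist_eq_norm y q]
    gcongr
  have h5 := (convex_closedBall q ‖x - q‖).norm_image_sub_le_of_norm_hasFDerivWithin_le hder hbound
    (Metric.mem_closedBall_self (norm_nonneg _)) (Metric.mem_closedBall.2 (dist_eq_norm x q).le)
  have h6 : φ x - φ q = F x - F q - B (x - q) (x - q) / 2 := by
    simp only [hφ, sub_self, map_zero]
    simp
    ring
  rw [h6, Real.norm_eq_abs] at h5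
  calc _ ≤ _ := h5
    _ = _ := by ring

lemma isLocalMin_of_second_order_pos [FiniteDimensional ℝ E]
    (hF : ∀ᶠ x in 𝓝 q, HasFDerivAt F (F' x) x) (hq : F' q = 0)
    (hF' : HasFDerivAt F' B q) (hB : ∀ u v, B u v = B v u) (hpos : ∀ v, v ≠ 0 → 0 < B v v) :
    IsLocalMin F q := by
  obtain ⟨κ, hκ, hlow⟩ : ∃ κ : ℝ, 0 < κ ∧ ∀ v, κ * ‖v‖ ^ 2 ≤ B v v := by
    have hprop : ProperSpace E := FiniteDimensional.proper_real E
    have hcont : Continuous fun v => B v v := by fun_prop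
    rcases (Metric.sphere (0 : E) 1).eq_empty_or_nonempty with hemp | hne
    · refine ⟨1, one_pos, fun v => ?_⟩
      have hv : v = 0 := by
        by_contra hv
        have : (‖v‖⁻¹ • v) ∈ Metric.sphere (0 : E) 1 := by
          simp [norm_smul, norm_ne_zero_iff.2 hv]
        simp [hemp] at this
      simp [hv]
    · obtain ⟨v₀, hv₀, hmin⟩ := (isCompact_sphere (0 : E) 1).exists_isMinOn hne hcont.continuousOn
      refine ⟨B v₀ v₀, hpos v₀ (by rintro rfl; simp at hv₀), fun v => ?_⟩
      rcases eq_or_ne v 0 with rfl | hv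
      · simp
      · have hn : 0 < ‖v‖ := norm_pos_iff.2 hv
        have h1 : B v₀ v₀ ≤ B (‖v‖⁻¹ • v) (‖v‖⁻¹ • v) := hmin (by simp [norm_smul, hn.ne'])
        have h2 : B v v = B (‖v‖⁻¹ • v) (‖v‖⁻¹ • v) * ‖v‖ ^ 2 := by
          simp
          field_simp
        rw [h2]
        gcongr
  -- An error of `κ / 2` is exactly what half of the form `B ≥ κ ‖·‖²` absorbs.
  filter_upwards [eventually_abs_sub_half_le hF hq hF' hB (half_pos hκ)] with x hx
  have := (abs_le.1 hx).1
  linarith [hlow (x - q)]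

lemma not_isLocalMin_of_second_order_neg
    (hF : ∀ᶠ x in 𝓝 q, HasFDerivAt F (F' x) x) (hq : F' q = 0)
    (hF' : HasFDerivAt F' B q) (hB : ∀ u v, B u v = B v u) {v : E} (hv : B v v < 0) :
    ¬ IsLocalMin F q := by
  intro hmin
  have hv0 : v ≠ 0 := by
    rintro rfl
    simp at hv
  have hn : 0 < ‖v‖ := norm_pos_iff.2 hv0
  -- With this `ε` the error along `q + s v` is `s² |B v v| / 4`, half the size of the quadratic
  -- term `s² B v v / 2`.
  have hε : 0 < - B v v / (4 * ‖v‖ ^ 2) := by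
    have : 0 < - B v v := by linarith
    positivity
  have hlim : Tendsto (fun s : ℝ => q + s • v) (𝓝[>] 0) (𝓝 q) := by
    have : Tendsto (fun s : ℝ => q + s • v) (𝓝 0) (𝓝 (q + (0 : ℝ) • v)) :=
      Continuous.tendsto (by fun_prop) 0
    rw [zero_smul, add_zero] at this
    exact this.mono_left nhdsWithin_le_nhds
  have hev := hlim.eventually ((eventually_abs_sub_half_le hF hq hF' hB hε).and hmin)
  obtain ⟨s, ⟨h1, h2⟩, hs⟩ := (hev.and self_mem_nhdsWithin).exists
  have hs : 0 < s := hs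
  have h3 := (abs_le.1 h1).2
  simp only [add_sub_cancel_left, map_smul, _root_.smul_apply, smul_eq_mul,
    norm_smul, Real.norm_eq_abs, mul_pow, sq_abs] at h3
  have h4 : - B v v / (4 * ‖v‖ ^ 2) * (s ^ 2 * ‖v‖ ^ 2) = - (s ^ 2 * B v v) / 4 := by
    field_simp
  rw [h4] at h3
  have h5 : s ^ 2 * B v v < 0 := mul_neg_of_pos_of_neg (by positivity) hv
  have h6 : F q ≤ F (q + s • v) := h2
  nlinarith

lemma not_isLocalMax_of_second_order_pos
    (hF : ∀ᶠ x in 𝓝 q, HasFDerivAt F (F' x) x) (hq : F' q = 0)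
    (hF' : HasFDerivAt F' B q) (hB : ∀ u v, B u v = B v u) {v : E} (hv : 0 < B v v) :
    ¬ IsLocalMax F q := by
  intro hmax
  have h1 : IsLocalMin (fun x => - F x) q := hmax.neg
  refine not_isLocalMin_of_second_order_neg (F := fun x => - F x) (F' := fun x => - F' x) (B := -B)
    (hF.mono fun x hx => hx.neg) (by simp [hq]) hF'.neg (fun u w => by simp [hB u w])
    (v := v) (by simpa using hv) h1

end SecondOrder

/-! ### Derivatives of sums of `x log x` terms. -/

section EntropySum

variable {E : Type*} [NormedAddCommGroup E] [NormedSpace ℝ E] {K : Type*} [Fintype K]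

/-- A linear functional plus a weighted sum of terms `x log x` of affine functionals. -/
noncomputable def entropySum (L : E →L[ℝ] ℝ) (w c : K → ℝ) (ℓ : K → E →L[ℝ] ℝ) (q : E) : ℝ :=
  L q + ∑ k, w k * xlogx (c k + ℓ k q)

noncomputable def entropySumGrad (L : E →L[ℝ] ℝ) (w c : K → ℝ) (ℓ : K → E →L[ℝ] ℝ) (q : E) :
    E →L[ℝ] ℝ :=
  L + ∑ k, (w k * (Real.log (c k + ℓ k q) + 1)) • ℓ k

noncomputable def entropySumHess (w c : K → ℝ) (ℓ : K → E →L[ℝ] ℝ) (q : E) :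
    E →L[ℝ] E →L[ℝ] ℝ :=
  ∑ k, (w k / (c k + ℓ k q)) • (ℓ k).smulRight (ℓ k)

variable {L : E →L[ℝ] ℝ} {w c : K → ℝ} {ℓ : K → E →L[ℝ] ℝ} {q : E}

lemma entropySumHess_apply (u v : E) :
    entropySumHess w c ℓ q u v = ∑ k, w k / (c k + ℓ k q) * (ℓ k u * ℓ k v) := by
  simp [entropySumHess]

lemma entropySumHess_comm (u v : E) :
    entropySumHess w c ℓ q u v = entropySumHess w c ℓ q v u := by
  simp only [entropySumHess_apply, mul_comm]

lemma hasFDerivAt_entropySum (hq : ∀ k, 0 < c k + ℓ k q) :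
    HasFDerivAt (entropySum L w c ℓ) (entropySumGrad L w c ℓ q) q := by
  refine L.hasFDerivAt.add (HasFDerivAt.fun_sum fun k _ => ?_)
  have h1 : HasFDerivAt (fun q => c k + ℓ k q) (ℓ k) q := (ℓ k).hasFDerivAt.const_add (c k)
  have h2 := ((Real.hasDerivAt_mul_log (hq k).ne').comp_hasFDerivAt q h1).const_mul (w k)
  rw [smul_smul] at h2
  exact h2

lemma hasFDerivAt_entropySumGrad (hq : ∀ k, 0 < c k + ℓ k q) :
    HasFDerivAt (entropySumGrad L w c ℓ) (entropySumHess w c ℓ q) q := by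
  refine HasFDerivAt.const_add L (HasFDerivAt.fun_sum fun k _ => ?_)
  have h1 : HasFDerivAt (fun q => c k + ℓ k q) (ℓ k) q := (ℓ k).hasFDerivAt.const_add (c k)
  have h2 := ((((Real.hasDerivAt_log (hq k).ne').comp_hasFDerivAt q h1).add_const 1).const_mul
    (w k)).smul_const (ℓ k)
  refine h2.congr_fderiv ?_
  ext u v
  simp
  ring

lemma eventually_hasFDerivAt_entropySum (hq : ∀ k, 0 < c k + ℓ k q) :
    ∀ᶠ x in 𝓝 q, HasFDerivAt (entropySum L w c ℓ) (entropySumGrad L w c ℓ x) x := by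
  have h1 : ∀ᶠ x in 𝓝 q, ∀ k, 0 < c k + ℓ k x := by
    rw [eventually_all]
    intro k
    have hc : Continuous fun x => c k + ℓ k x := by fun_prop
    exact (hc.tendsto q).eventually (lt_mem_nhds (hq k))
  exact h1.mono fun x hx => hasFDerivAt_entropySum hx

lemma fderiv_fderiv_entropySum (hq : ∀ k, 0 < c k + ℓ k q) :
    fderiv ℝ (fderiv ℝ (entropySum L w c ℓ)) q = entropySumHess w c ℓ q := by
  have h1 : fderiv ℝ (entropySum L w c ℓ) =ᶠ[𝓝 q] entropySumGrad L w c ℓ :=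
    (eventually_hasFDerivAt_entropySum hq).mono fun x hx => hx.fderiv
  rw [h1.fderiv_eq, (hasFDerivAt_entropySumGrad hq).fderiv]

end EntropySum

end BetheLBP

namespace BetheLBP

/-! ### Powers and resolvents of matrices with spectrum in the open disc. -/

section PowerTendsto

open Matrix

variable {n : Type*} [Fintype n] [DecidableEq n]

attribute [local instance] Matrix.linftyOpNormedRing Matrix.linftyOpNormedAlgebra in
-- Gelfand's formula: the spectral radius is below some `r < 1`, so `‖A ^ k‖ ≤ r ^ k` eventually.
-- The empty index type is separate because the matrix ring must be nontrivial.
lemma tendsto_pow_zero_of_spectrum_lt_one {A : Matrix n n ℂ}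
    (hA : ∀ z ∈ spectrum ℂ A, ‖z‖ < 1) : Tendsto (fun k : ℕ => A ^ k) atTop (𝓝 0) := by
  cases isEmpty_or_nonempty n
  · have : (fun k : ℕ => A ^ k) = fun _ => 0 := funext fun k => Subsingleton.elim _ _
    rw [this]
    exact tendsto_const_nhds
  have hnt : Nontrivial (Matrix n n ℂ) := inferInstance
  have hrad : spectralRadius ℂ A < 1 := by
    refine spectrum.spectralRadius_lt_of_forall_lt (r := 1) A fun z hz => ?_
    rw [← NNReal.coe_lt_coe]
    exact hA z hz
  obtain ⟨r, hr1, hr2⟩ := exists_between hrad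
  have hlim := spectrum.pow_nnnorm_pow_one_div_tendsto_nhds_spectralRadius A
  have hr : Tendsto (fun k : ℕ => r ^ k) atTop (𝓝 0) := by
    exact ENNReal.tendsto_pow_atTop_nhds_zero_of_lt_one hr2
  have hle : ∀ᶠ k : ℕ in atTop, (‖A ^ k‖₊ : ENNReal) ≤ r ^ k := by
    filter_upwards [hlim.eventually (gt_mem_nhds hr1), eventually_gt_atTop 0] with k hk hk0
    have h1 := ENNReal.rpow_le_rpow hk.le (Nat.cast_nonneg (α := ℝ) k)
    rwa [← ENNReal.rpow_mul, one_div, inv_mul_cancel₀ (by positivity), ENNReal.rpow_one,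
      ENNReal.rpow_natCast] at h1
  have h0 : Tendsto (fun k : ℕ => (‖A ^ k‖₊ : ENNReal)) atTop (𝓝 0) :=
    tendsto_of_tendsto_of_tendsto_of_le_of_le' tendsto_const_nhds hr
      (Eventually.of_forall fun k => bot_le) hle
  refine tendsto_zero_iff_norm_tendsto_zero.2 ?_
  have h1 := (ENNReal.tendsto_toReal ENNReal.zero_ne_top).comp h0
  simpa [Function.comp_def] using h1

/-- A nonnegative matrix with spectrum in the open unit disc: the resolvent at `1` preserves
nonnegative vectors. -/
lemma exists_nonneg_eq_mulVec_add {N : Matrix n n ℝ} (hN : ∀ i j, 0 ≤ N i j)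
    (hs : ∀ z ∈ spectrum ℂ (N.map Complex.ofReal), ‖z‖ < 1) {b : n → ℝ} (hb : ∀ i, 0 ≤ b i) :
    ∃ w : n → ℝ, (∀ i, 0 ≤ w i) ∧ w = N *ᵥ w + b := by
  have hpow : Tendsto (fun k : ℕ => N ^ k) atTop (𝓝 0) := by
    have h1 := tendsto_pow_zero_of_spectrum_lt_one hs
    have h2 : Continuous fun M : Matrix n n ℂ => M.map Complex.re := by
      exact continuous_id.matrix_map Complex.continuous_re
    have h3 := (h2.tendsto 0).comp h1
    have h4 : ((fun M : Matrix n n ℂ => M.map Complex.re) ∘ fun k : ℕ =>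
        (N.map Complex.ofReal) ^ k) = fun k => N ^ k := by
      funext k
      have h5 : (N.map Complex.ofReal) ^ k = (N ^ k).map Complex.ofReal :=
        (map_pow (Complex.ofRealHom.mapMatrix (m := n)) N k).symm
      simp only [Function.comp_apply, h5]
      ext i j
      simp
    rw [h4] at h3
    simpa using h3
  -- A vector fixed by `N` would be fixed by all `N ^ k`, which tend to `0`.
  have hdet : (1 - N).det ≠ 0 := by
    intro h0
    obtain ⟨x, hx, hx0⟩ := Matrix.exists_mulVec_eq_zero_iff.2 h0
    rw [sub_mulVec, one_mulVec, sub_eq_zero] at hx0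
    have h1 : ∀ k : ℕ, N ^ k *ᵥ x = x := by
      intro k
      induction k with
      | zero => simp
      | succ k ih => rw [pow_succ, ← mulVec_mulVec, ← hx0, ih]
    have h2 : Tendsto (fun k : ℕ => N ^ k *ᵥ x) atTop (𝓝 ((0 : Matrix n n ℝ) *ᵥ x)) :=
      ((Continuous.matrix_mulVec continuous_id continuous_const).tendsto _).comp hpow
    simp only [h1, zero_mulVec] at h2
    exact hx (tendsto_nhds_unique tendsto_const_nhds h2)
  set w := (1 - N)⁻¹ *ᵥ b with hw
  have hweq : w = N *ᵥ w + b := by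
    have : (1 - N) *ᵥ w = b := by
      rw [hw, mulVec_mulVec, mul_nonsing_inv _ (isUnit_iff_ne_zero.2 hdet), one_mulVec]
    rw [sub_mulVec, one_mulVec] at this
    rw [← this]
    abel
  have hNk : ∀ k : ℕ, ∀ x y : n → ℝ, (∀ i, x i ≤ y i) → ∀ i, (N ^ k *ᵥ x) i ≤ (N ^ k *ᵥ y) i := by
    intro k
    induction k with
    | zero => simp
    | succ k ih =>
      intro x y hxy i
      rw [pow_succ, ← mulVec_mulVec, ← mulVec_mulVec]
      exact ih _ _ (fun j => Finset.sum_le_sum fun l _ =>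
        mul_le_mul_of_nonneg_left (hxy l) (hN j l)) i
  -- `b ≥ 0` means `N w ≤ w`; monotonicity of the powers iterates this, and the limit `k → ∞` yields
  -- `0 ≤ w`.
  have hiter : ∀ k : ℕ, ∀ i, (N ^ k *ᵥ w) i ≤ w i := by
    intro k
    induction k with
    | zero => simp
    | succ k ih =>
      intro i
      rw [pow_succ, ← mulVec_mulVec]
      refine (hNk k _ _ (fun j => ?_) i).trans (ih i)
      have := congrFun hweq j
      rw [Pi.add_apply] at this
      linarith [hb j]
  refine ⟨w, fun i => ?_, hweq⟩
  have h2 : Tendsto (fun k : ℕ => N ^ k *ᵥ w) atTop (𝓝 ((0 : Matrix n n ℝ) *ᵥ w)) :=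
    ((Continuous.matrix_mulVec continuous_id continuous_const).tendsto _).comp hpow
  rw [zero_mulVec, tendsto_pi_nhds] at h2
  exact le_of_tendsto (h2 i) (Eventually.of_forall fun k => hiter k i)

end PowerTendsto

/-! ### The non-backtracking matrix and the reduced Hessian. -/

section NonBacktracking

open Matrix

variable {V : Type*} [Fintype V] [DecidableEq V] {G : SimpleGraph V} [DecidableRel G.Adj]

omit [Fintype V] [DecidableEq V] [DecidableRel G.Adj] in
@[simp] lemma dart_symm_fst (d : G.Dart) : d.symm.fst = d.snd := rfl

omit [Fintype V] [DecidableEq V] [DecidableRel G.Adj] in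
@[simp] lemma dart_symm_snd (d : G.Dart) : d.symm.snd = d.fst := rfl

/-- Symmetric, nonnegative edge covariances `c` that are compatible with the variances `v`. -/
structure IsCovariance (v : V → ℝ) (c : G.Dart → ℝ) : Prop where
  var_pos : ∀ i, 0 < v i
  nonneg : ∀ d, 0 ≤ c d
  symm : ∀ d : G.Dart, c d.symm = c d
  sq_lt : ∀ d : G.Dart, c d ^ 2 < v d.fst * v d.snd

/-- The darts that enter the tail of `d` and are not the reverse of `d`. -/
def preds (d : G.Dart) : Finset G.Dart :=
  Finset.univ.filter fun c : G.Dart => c.snd = d.fst ∧ c.fst ≠ d.snd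

lemma mem_preds {c d : G.Dart} : c ∈ preds d ↔ c.snd = d.fst ∧ c.fst ≠ d.snd := by
  simp [preds]

/-- The darts that enter a vertex. -/
def incoming (G : SimpleGraph V) [DecidableRel G.Adj] (i : V) : Finset G.Dart :=
  Finset.univ.filter fun c : G.Dart => c.snd = i

lemma mem_incoming {c : G.Dart} {i : V} : c ∈ incoming G i ↔ c.snd = i := by
  simp [incoming]

lemma symm_notMem_preds (d : G.Dart) : d.symm ∉ preds d := by
  simp [mem_preds]

lemma incoming_fst_eq_insert (d : G.Dart) : incoming G d.fst = insert d.symm (preds d) := by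
  ext c
  rw [mem_incoming, Finset.mem_insert, mem_preds]
  constructor
  · intro h
    by_cases h' : c.fst = d.snd
    · left
      ext <;> simp [h, h']
    · exact Or.inr ⟨h, h'⟩
  · rintro (rfl | h)
    · simp
    · exact h.1

lemma sum_incoming_fst (d : G.Dart) (w : G.Dart → ℝ) :
    ∑ c ∈ incoming G d.fst, w c = w d.symm + ∑ c ∈ preds d, w c := by
  rw [incoming_fst_eq_insert, Finset.sum_insert (symm_notMem_preds d)]

lemma sum_incoming_eq_sum_outgoing (i : V) (w : G.Dart → ℝ) :
    ∑ d ∈ incoming G i, w d = ∑ d ∈ Finset.univ.filter (fun d : G.Dart => d.fst = i), w d.symm := by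
  refine Finset.sum_nbij' (fun d => d.symm) (fun d => d.symm) ?_ ?_ ?_ ?_ ?_ <;>
    simp [mem_incoming]

/-- The weighted non-backtracking matrix. -/
def nonBacktracking (u : G.Dart → ℝ) : Matrix G.Dart G.Dart ℝ :=
  Matrix.of fun d c => if c ∈ preds d then u d else 0

lemma nonBacktracking_mulVec (u : G.Dart → ℝ) (w : G.Dart → ℝ) (d : G.Dart) :
    (nonBacktracking u *ᵥ w) d = u d * ∑ c ∈ preds d, w c := by
  simp only [mulVec, dotProduct, nonBacktracking, of_apply, ite_mul, zero_mul]
  rw [← Finset.sum_filter, Finset.mul_sum]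
  simp

/-- The determinant of the covariance matrix of an edge. -/
def gap (v : V → ℝ) (c : G.Dart → ℝ) (d : G.Dart) : ℝ := v d.fst * v d.snd - c d ^ 2

/-- The Hessian of the Bethe free energy after elimination of the correlations. -/
noncomputable def reducedHessian (v : V → ℝ) (c : G.Dart → ℝ) : Matrix V V ℝ :=
  diagonal (fun i => (v i)⁻¹ +
      ∑ d ∈ incoming G i, c d ^ 2 / (v i * gap v c d)) -
    Matrix.of fun i j => ∑ d ∈ (incoming G i).filter (fun d => d.fst = j), c d / gap v c d

/-- The flow along darts that is induced by a vector on the vertices. -/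
noncomputable def flow (v : V → ℝ) (c : G.Dart → ℝ) (f : V → ℝ) (d : G.Dart) : ℝ :=
  c d / gap v c d * (f d.fst - c d * f d.snd / v d.snd)

variable {v : V → ℝ} {c : G.Dart → ℝ}

lemma reducedHessian_mulVec (f : V → ℝ) (i : V) :
    (reducedHessian v c *ᵥ f) i = f i / v i - ∑ d ∈ incoming G i, flow v c f d := by
  rw [reducedHessian, sub_mulVec, Pi.sub_apply, mulVec_diagonal]
  have h1 : ((Matrix.of fun i j => ∑ d ∈ (incoming G i).filter (fun d => d.fst = j),
      c d / gap v c d) *ᵥ f) i = ∑ d ∈ incoming G i, c d / gap v c d * f d.fst := by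
    simp only [mulVec, dotProduct, of_apply]
    rw [← Finset.sum_fiberwise (incoming G i) (fun d => d.fst)]
    refine Finset.sum_congr rfl fun j _ => ?_
    rw [Finset.sum_mul]
    refine Finset.sum_congr rfl fun d hd => ?_
    rw [(Finset.mem_filter.1 hd).2]
  rw [h1, add_mul, Finset.sum_mul, add_sub_assoc, ← Finset.sum_sub_distrib, sub_eq_add_neg,
    ← Finset.sum_neg_distrib]
  congr 1
  · rw [div_eq_inv_mul]
  · refine Finset.sum_congr rfl fun d hd => ?_
    rw [flow, mem_incoming.1 hd, mul_comm (v i), ← div_div]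
    ring

namespace IsCovariance

variable (h : IsCovariance v c)
include h

omit [Fintype V] [DecidableEq V] [DecidableRel G.Adj] in
lemma gap_pos (d : G.Dart) : 0 < gap v c d := sub_pos.2 (h.sq_lt d)

omit [Fintype V] [DecidableEq V] [DecidableRel G.Adj] in
lemma gap_symm (d : G.Dart) : gap v c d.symm = gap v c d := by
  simp [gap, h.symm, mul_comm]

lemma isSymm_reducedHessian : (reducedHessian v c).IsSymm := by
  rw [reducedHessian]
  refine (isSymm_diagonal _).sub ?_
  ext i j
  simp only [transpose_apply, of_apply]
  refine Finset.sum_nbij' (fun d => d.symm) (fun d => d.symm) ?_ ?_ ?_ ?_ ?_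
  · simp +contextual [mem_incoming]
  · simp +contextual [mem_incoming]
  · simp
  · simp
  · simp [h.symm, h.gap_symm]

lemma reducedHessian_off_diag_nonpos (i j : V) (hij : i ≠ j) : reducedHessian v c i j ≤ 0 := by
  rw [reducedHessian, Matrix.sub_apply, diagonal_apply_ne _ hij, zero_sub, of_apply,
    neg_nonpos]
  exact Finset.sum_nonneg fun d _ => div_nonneg (h.nonneg d) (h.gap_pos d).le

lemma reducedHessian_off_diag_neg (d : G.Dart) (hd : 0 < c d) :
    reducedHessian v c d.fst d.snd < 0 := by
  rw [reducedHessian, Matrix.sub_apply, diagonal_apply_ne _ d.adj.ne, zero_sub, of_apply,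
    neg_lt_zero]
  refine Finset.sum_pos' (fun d _ => div_nonneg (h.nonneg d) (h.gap_pos d).le)
    ⟨d.symm, by simp [mem_incoming], ?_⟩
  rw [h.symm, h.gap_symm]
  exact div_pos hd (h.gap_pos d)

lemma dotProduct_reducedHessian (f : V → ℝ) :
    f ⬝ᵥ reducedHessian v c *ᵥ f = ∑ i, f i ^ 2 / v i +
      ∑ d : G.Dart, c d / gap v c d * (c d * f d.fst ^ 2 / v d.fst - f d.fst * f d.snd) := by
  have h1 : ∀ i, f i * (reducedHessian v c *ᵥ f) i = f i ^ 2 / v i +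
      ∑ d ∈ Finset.univ.filter (fun d : G.Dart => d.fst = i),
        c d / gap v c d * (c d * f d.fst ^ 2 / v d.fst - f d.fst * f d.snd) := by
    intro i
    rw [reducedHessian_mulVec, sum_incoming_eq_sum_outgoing, mul_sub, Finset.mul_sum,
      sub_eq_add_neg, ← Finset.sum_neg_distrib]
    congr 1
    · ring
    · refine Finset.sum_congr rfl fun d hd => ?_
      have hd' : d.fst = i := (Finset.mem_filter.1 hd).2
      subst hd'
      simp only [flow, h.symm, h.gap_symm, dart_symm_fst, dart_symm_snd]
      ring
  rw [dotProduct, Finset.sum_congr rfl fun i _ => h1 i, Finset.sum_add_distrib,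
    Finset.sum_fiberwise]

omit [Fintype V] [DecidableEq V] [DecidableRel G.Adj] in
-- The relations at `d` and `d.symm` form a linear system in `w d`, `w d.symm` with determinant `gap
-- / (v d.fst * v d.snd) ≠ 0`, so the flow is its only solution.
lemma eq_flow_of_eq {f : V → ℝ} {w : G.Dart → ℝ}
    (hw : ∀ d : G.Dart, w d = c d / v d.snd * (f d.fst / v d.fst - w d.symm)) (d : G.Dart) :
    w d = flow v c f d := by
  have h1 := hw d
  have h2 := hw d.symm
  simp only [SimpleGraph.Dart.symm_symm, h.symm, dart_symm_fst,
    dart_symm_snd] at h2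
  have hv1 := h.var_pos d.fst
  have hv2 := h.var_pos d.snd
  have hg := h.gap_pos d
  rw [flow]
  rw [h2] at h1
  rw [eq_comm, div_mul_eq_mul_div, div_eq_iff hg.ne', gap]
  field_simp at h1 ⊢
  linear_combination -h1

omit [Fintype V] [DecidableEq V] [DecidableRel G.Adj] in
lemma flow_eq (f : V → ℝ) (d : G.Dart) :
    flow v c f d = c d / v d.snd * (f d.fst / v d.fst - flow v c f d.symm) := by
  have hv1 := h.var_pos d.fst
  have hv2 := h.var_pos d.snd
  have hg := h.gap_pos d
  simp only [flow, h.symm, h.gap_symm, dart_symm_fst, dart_symm_snd]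
  field_simp
  rw [gap]
  ring

/-- The bridge between darts and vertices. In `flow_eq` the term `f d.fst / v d.fst` is `Y f` at the
tail plus the total inflow there, and the subtracted reverse flow cancels exactly the backtracking
summand. -/
lemma flow_eq_sum_preds (f : V → ℝ) (d : G.Dart) :
    flow v c f d = c d / v d.snd *
      (∑ c' ∈ preds d, flow v c f c' + (reducedHessian v c *ᵥ f) d.fst) := by
  rw [reducedHessian_mulVec, sum_incoming_fst, h.flow_eq f d]
  ring

/-- Stability implies that the reduced Hessian is positive definite. -/
lemma posDef_of_spectrum
    (hs : ∀ z ∈ spectrum ℂ ((nonBacktracking fun d : G.Dart => c d / v d.snd).map Complex.ofReal),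
      ‖z‖ < 1) : (reducedHessian v c).PosDef := by
  have hu : ∀ d : G.Dart, 0 ≤ c d / v d.snd := fun d => div_nonneg (h.nonneg d) (h.var_pos _).le
  obtain ⟨w, hw0, hw⟩ := exists_nonneg_eq_mulVec_add (b := fun d : G.Dart => c d / v d.snd)
    (fun d e => by
      simp only [nonBacktracking, of_apply]
      split_ifs
      exacts [hu d, le_rfl]) hs hu
  -- Chosen so that `f i / v i` exceeds the inflow at `i` by exactly `1`: once `w` is known to be
  -- the flow of `f`, the image `Y f` is the constant `1`.
  set f : V → ℝ := fun i => v i * (1 + ∑ d ∈ incoming G i, w d) with hf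
  have hfv : ∀ i, f i / v i = 1 + ∑ d ∈ incoming G i, w d := fun i => by
    simp only [hf]
    rw [mul_div_cancel_left₀ _ (h.var_pos i).ne']
  have hfpos : ∀ i, 0 < f i := fun i =>
    mul_pos (h.var_pos i)
      (add_pos_of_pos_of_nonneg one_pos (Finset.sum_nonneg fun d _ => hw0 d))
  have hwf : ∀ d, w d = flow v c f d := by
    refine h.eq_flow_of_eq fun d => ?_
    have h1 := congrFun hw d
    rw [Pi.add_apply, nonBacktracking_mulVec] at h1
    rw [hfv, sum_incoming_fst, h1]
    ring
  refine posDef_of_mulVec_pos h.isSymm_reducedHessian h.reducedHessian_off_diag_nonpos hfpos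
    fun i => ?_
  rw [reducedHessian_mulVec, hfv, ← Finset.sum_congr rfl fun d _ => hwf d]
  simp

/-- If the reduced Hessian is positive semidefinite, then every eigenvalue of the
non-backtracking matrix lies in the closed unit disc. -/
lemma norm_le_one_of_mem_spectrum (hY : ∀ x, 0 ≤ x ⬝ᵥ reducedHessian v c *ᵥ x) {z : ℂ}
    (hz : z ∈ spectrum ℂ ((nonBacktracking fun d : G.Dart => c d / v d.snd).map Complex.ofReal)) :
    ‖z‖ ≤ 1 := by
  obtain ⟨f, hf, hYf⟩ := exists_pos_mulVec_nonneg h.isSymm_reducedHessian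
    h.reducedHessian_off_diag_nonpos hY
  set w := flow v c f with hw
  set g : G.Dart → ℝ := fun d => f d.fst ^ 2 / v d.fst with hg
  -- the potential `g` decreases backwards along darts with nonpositive flow
  have hdec : ∀ d : G.Dart, ∀ e ∈ preds d, w e ≤ 0 → 0 < c e → g e < g d := by
    intro d e he hwe hce
    have hvd := h.var_pos d.fst
    have hve := h.var_pos e.fst
    have hes : e.snd = d.fst := (mem_preds.1 he).1
    have hge := h.gap_pos e
    have h1 : f e.fst ≤ c e * f d.fst / v d.fst := by
      by_contra! hlt
      have : 0 < w e := by
        rw [hw, flow, hes]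
        exact mul_pos (div_pos hce hge) (sub_pos.2 hlt)
      linarith
    have h2 := h.sq_lt e
    rw [hes] at h2
    have h3 : f e.fst ^ 2 ≤ (c e * f d.fst / v d.fst) ^ 2 :=
      pow_le_pow_left₀ (hf _).le h1 2
    have hfd := hf d.fst
    simp only [hg]
    rw [div_lt_iff₀ hve]
    refine h3.trans_lt ?_
    have h4 : (c e * f d.fst / v d.fst) ^ 2 = c e ^ 2 * (f d.fst ^ 2 / v d.fst ^ 2) := by
      field_simp
    have h5 : f d.fst ^ 2 / v d.fst * v e.fst = v e.fst * v d.fst * (f d.fst ^ 2 / v d.fst ^ 2) := by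
      field_simp
    rw [h4, h5]
    exact mul_lt_mul_of_pos_right h2 (by positivity)
  have hu : ∀ d : G.Dart, 0 ≤ c d / v d.snd := fun d => div_nonneg (h.nonneg d) (h.var_pos _).le
  have hrec : ∀ d, w d = c d / v d.snd * (∑ e ∈ preds d, w e + (reducedHessian v c *ᵥ f) d.fst) :=
    h.flow_eq_sum_preds f
  -- Among darts of negative flow take one minimizing `g`. As `Y f ≥ 0`, the recursion forces a
  -- predecessor of negative flow, whose `g` is smaller by `hdec`.
  have hw0 : ∀ d, 0 ≤ w d := by
    by_contra! hneg
    have hne : (Finset.univ.filter fun d => w d < 0).Nonempty := by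
      obtain ⟨d, hd⟩ := hneg
      exact ⟨d, by simpa using hd⟩
    obtain ⟨d, hd, hmin⟩ := Finset.exists_min_image _ g hne
    simp only [Finset.mem_filter, Finset.mem_univ, true_and] at hd hmin
    have h1 : ∑ e ∈ preds d, w e < 0 := by
      by_contra! h1
      have := hrec d
      have := mul_nonneg (hu d) (add_nonneg h1 (hYf d.fst))
      linarith
    obtain ⟨e, he, hwe⟩ := Finset.exists_lt_of_sum_lt (g := fun _ => (0 : ℝ)) (by simpa using h1)
    have hce : 0 < c e := by
      refine lt_of_le_of_ne (h.nonneg e) fun h0 => ?_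
      rw [hw, flow, ← h0] at hwe
      simp at hwe
    exact absurd (hmin e hwe) (not_le.2 (hdec d e he hwe.le hce))
  -- an eigenvector
  obtain ⟨x, hx, hx0⟩ : ∃ x : G.Dart → ℂ, x ≠ 0 ∧
      ((nonBacktracking fun d : G.Dart => c d / v d.snd).map Complex.ofReal) *ᵥ x = z • x := by
    rw [spectrum.mem_iff, Matrix.isUnit_iff_isUnit_det, isUnit_iff_ne_zero, not_not,
      ← Matrix.exists_mulVec_eq_zero_iff] at hz
    obtain ⟨x, hx, hx0⟩ := hz
    refine ⟨x, hx, ?_⟩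
    rw [sub_mulVec, sub_eq_zero, Algebra.algebraMap_eq_smul_one, smul_mulVec, one_mulVec] at hx0
    exact hx0.symm
  rcases eq_or_ne z 0 with rfl | hz0
  · simp
  have heig : ∀ d, z * x d = (c d / v d.snd : ℝ) * ∑ e ∈ preds d, x e := by
    intro d
    have h1 := congrFun hx0 d
    simp only [mulVec, dotProduct, nonBacktracking, map_apply, of_apply, Pi.smul_apply,
      smul_eq_mul, apply_ite Complex.ofReal, Complex.ofReal_zero, ite_mul, zero_mul] at h1
    rw [← h1, ← Finset.sum_filter, Finset.mul_sum]
    simp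
  have hcx : ∀ d, x d ≠ 0 → 0 < c d := by
    intro d hd
    refine lt_of_le_of_ne (h.nonneg d) fun h0 => ?_
    have := heig d
    rw [← h0] at this
    simp [hz0, hd] at this
  -- The same descent on the support of `x`: the eigenvalue equation gives a predecessor in the
  -- support, and a vanishing flow at `d` forces vanishing flow there because all flows are
  -- nonnegative.
  have hwx : ∀ d, x d ≠ 0 → 0 < w d := by
    by_contra! hneg
    have hne : (Finset.univ.filter fun d => x d ≠ 0 ∧ w d ≤ 0).Nonempty := by
      obtain ⟨d, hd⟩ := hneg
      exact ⟨d, by simpa using hd⟩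
    obtain ⟨d, hd, hmin⟩ := Finset.exists_min_image _ g hne
    simp only [Finset.mem_filter, Finset.mem_univ, true_and] at hd hmin
    obtain ⟨e, he, hxe⟩ : ∃ e ∈ preds d, x e ≠ 0 := by
      by_contra! hall
      have := heig d
      rw [Finset.sum_eq_zero hall] at this
      simp [hz0, hd.1] at this
    have h1 : ∑ e ∈ preds d, w e ≤ 0 := by
      by_contra! h1
      have h2 := hrec d
      have h3 := mul_pos (div_pos (hcx d hd.1) (h.var_pos d.snd))
        (add_pos_of_pos_of_nonneg h1 (hYf d.fst))
      linarith [hd.2]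
    have h2 : w e ≤ 0 :=
      (Finset.single_le_sum (fun e _ => hw0 e) he).trans h1
    exact absurd (hmin e ⟨hxe, h2⟩) (not_le.2 (hdec d e he h2 (hcx e hxe)))
  have hne : (Finset.univ.filter fun d => x d ≠ 0).Nonempty := by
    obtain ⟨d, hd⟩ := Function.ne_iff.1 hx
    exact ⟨d, by simpa using hd⟩
  -- Collatz–Wielandt comparison: where `‖x d‖ / w d` is maximal, `M w ≤ w` bounds `‖z‖ * ‖x d‖` by
  -- `‖x d‖`.
  obtain ⟨d, hd, hmax⟩ := Finset.exists_max_image _ (fun d => ‖x d‖ / w d) hne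
  simp only [Finset.mem_filter, Finset.mem_univ, true_and] at hd hmax
  set R := ‖x d‖ / w d with hR
  have hR0 : 0 ≤ R := div_nonneg (norm_nonneg _) (hw0 d)
  have hle : ∀ e, ‖x e‖ ≤ R * w e := by
    intro e
    by_cases he : x e = 0
    · simpa [he] using mul_nonneg hR0 (hw0 e)
    · exact (div_le_iff₀ (hwx e he)).1 (hmax e he)
  have hfin : ‖z‖ * ‖x d‖ ≤ 1 * ‖x d‖ := by
    calc ‖z‖ * ‖x d‖ = c d / v d.snd * ‖∑ e ∈ preds d, x e‖ := by
          rw [← norm_mul, heig d, norm_mul, Complex.norm_real, Real.norm_of_nonneg (hu d)]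
      _ ≤ c d / v d.snd * ∑ e ∈ preds d, R * w e :=
          mul_le_mul_of_nonneg_left ((norm_sum_le _ _).trans
            (Finset.sum_le_sum fun e _ => hle e)) (hu d)
      _ ≤ R * w d := by
          rw [← Finset.mul_sum, hrec d]
          have := mul_nonneg hR0 (mul_nonneg (hu d) (hYf d.fst))
          linarith
      _ = 1 * ‖x d‖ := by
          rw [hR, div_mul_cancel₀ _ (hwx d hd).ne', one_mul]
  exact le_of_mul_le_mul_right hfin (norm_pos_iff.2 hd)

/-- If all covariances are positive on a connected graph, then a vector in the kernel of a
positive semidefinite reduced Hessian that vanishes at one vertex vanishes identically. -/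
lemma eq_zero_of_dotProduct_eq_zero (hG : G.Connected) (hc : ∀ d, 0 < c d)
    (hY : ∀ x, 0 ≤ x ⬝ᵥ reducedHessian v c *ᵥ x) {x : V → ℝ}
    (hx : x ⬝ᵥ reducedHessian v c *ᵥ x = 0) {i : V} (hi : x i = 0) : x = 0 := by
  have hker := mulVec_abs_eq_zero h.isSymm_reducedHessian h.reducedHessian_off_diag_nonpos hY hx
  -- Since `|x|` is also in the kernel and every edge has a strictly negative entry, zeros propagate
  -- to neighbours.
  have hstep : ∀ i j, G.Adj i j → x i = 0 → x j = 0 := by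
    intro i j hij hxi
    have h1 := apply_mul_eq_zero_of_mulVec_eq_zero h.reducedHessian_off_diag_nonpos
      (fun i => abs_nonneg (x i)) hker (i := i) (by simpa using hxi) j
    have h2 := h.reducedHessian_off_diag_neg ⟨(i, j), hij⟩ (hc _)
    exact abs_eq_zero.1 ((mul_eq_zero.1 h1).resolve_left h2.ne)
  funext j
  obtain ⟨p⟩ := hG.preconnected i j
  induction p with
  | nil => exact hi
  | cons hadj p ih => exact ih (hstep _ _ hadj hi)

end IsCovariance

end NonBacktracking

end BetheLBP

namespace BetheLBP

/-! ### Beliefs at a fixed point as consistent pseudo-marginals. -/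

section Beliefs

variable {V : Type*} [Fintype V] [DecidableEq V] {G : SimpleGraph V} [DecidableRel G.Adj]
  {J : G.edgeSet → ℝ} {h : V → ℝ} {η : G.Dart → ℝ}

@[simp] lemma spin_true : spin true = 1 := rfl

@[simp] lemma spin_false : spin false = -1 := rfl

omit [Fintype V] [DecidableEq V] [DecidableRel G.Adj] in
@[simp] lemma undirected_symm (d : G.Dart) : undirected d.symm = undirected d :=
  Subtype.ext d.edge_symm

omit [Fintype V] [DecidableEq V] [DecidableRel G.Adj] in
@[simp] lemma undirected_orient (e : G.edgeSet) : undirected (orient G e) = e :=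
  Subtype.ext (Quot.out_eq e.1)

omit [Fintype V] [DecidableEq V] [DecidableRel G.Adj] in
lemma orient_undirected (d : G.Dart) :
    orient G (undirected d) = d ∨ orient G (undirected d) = d.symm := by
  rw [← SimpleGraph.dart_edge_eq_iff]
  exact congrArg Subtype.val (undirected_orient (undirected d))

omit [Fintype V] [DecidableEq V] [DecidableRel G.Adj] in
lemma psiPair_symm (d : G.Dart) (x y : Bool) : psiPair J d.symm y x = psiPair J d x y := by
  simp only [psiPair, undirected_symm]
  ring_nf

omit [Fintype V] [DecidableEq V] [DecidableRel G.Adj] in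
lemma psiPair_pos (d : G.Dart) (x y : Bool) : 0 < psiPair J d x y :=
  Real.exp_pos _

omit [Fintype V] [DecidableEq V] [DecidableRel G.Adj] in
lemma message_pos (hη : ∀ e, 0 < η e) (e : G.Dart) (x : Bool) : 0 < message η e x := by
  cases x <;> simp [message, hη e]

lemma cavity_eq (d : G.Dart) (x : Bool) :
    cavity h η d x = psiVertex h d.fst x * ∏ c ∈ preds d, message η c x := rfl

lemma cavity_pos (hη : ∀ e, 0 < η e) (d : G.Dart) (x : Bool) : 0 < cavity h η d x :=
  mul_pos (Real.exp_pos _) (Finset.prod_pos fun e _ => message_pos hη e x)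

lemma vertexWeight_pos (hη : ∀ e, 0 < η e) (i : V) (x : Bool) : 0 < vertexWeight h η i x :=
  mul_pos (Real.exp_pos _) (Finset.prod_pos fun e _ => message_pos hη e x)

lemma pairWeight_pos (hη : ∀ e, 0 < η e) (d : G.Dart) (x y : Bool) :
    0 < pairWeight J h η d x y :=
  mul_pos (mul_pos (psiPair_pos _ _ _) (cavity_pos hη _ _)) (cavity_pos hη _ _)

lemma updatedMessage_pos (hη : ∀ e, 0 < η e) (d : G.Dart) (y : Bool) :
    0 < updatedMessage J h η d y :=
  Finset.sum_pos (fun _ _ => mul_pos (psiPair_pos _ _ _) (cavity_pos hη _ _))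
    Finset.univ_nonempty

lemma vertexWeight_fst (d : G.Dart) (x : Bool) :
    vertexWeight h η d.fst x = message η d.symm x * cavity h η d x := by
  have h1 : vertexWeight h η d.fst x
      = psiVertex h d.fst x * ∏ c ∈ incoming G d.fst, message η c x := rfl
  rw [h1, incoming_fst_eq_insert, Finset.prod_insert (symm_notMem_preds d), cavity_eq]
  ring

lemma pairWeight_symm (d : G.Dart) (x y : Bool) :
    pairWeight J h η d.symm y x = pairWeight J h η d x y := by
  simp only [pairWeight, psiPair_symm, SimpleGraph.Dart.symm_symm]
  ring

lemma pairBelief_symm (d : G.Dart) (x y : Bool) :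
    pairBelief J h η d.symm y x = pairBelief J h η d x y := by
  simp only [pairBelief, pairWeight_symm]
  rw [Finset.sum_comm]

lemma pairBelief_pos (hη : ∀ e, 0 < η e) (d : G.Dart) (x y : Bool) :
    0 < pairBelief J h η d x y :=
  div_pos (pairWeight_pos hη _ _ _) (Finset.sum_pos (fun _ _ => Finset.sum_pos
    (fun _ _ => pairWeight_pos hη _ _ _) Finset.univ_nonempty) Finset.univ_nonempty)

lemma vertexBelief_pos (hη : ∀ e, 0 < η e) (i : V) (x : Bool) : 0 < vertexBelief h η i x :=
  div_pos (vertexWeight_pos hη _ _) (Finset.sum_pos (fun _ _ => vertexWeight_pos hη _ _)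
    Finset.univ_nonempty)

lemma vertexBelief_add (hη : ∀ e, 0 < η e) (i : V) :
    vertexBelief h η i true + vertexBelief h η i false = 1 := by
  have h1 := vertexWeight_pos (h := h) hη i true
  have h2 := vertexWeight_pos (h := h) hη i false
  simp only [vertexBelief, Fintype.sum_bool]
  field_simp

lemma one_add_beliefPoint_inl (hη : ∀ e, 0 < η e) (i : V) (x : Bool) :
    1 + beliefPoint J h η (Sum.inl i) * spin x = 2 * vertexBelief h η i x := by
  have h1 := vertexBelief_add (h := h) hη i
  cases x <;> simp [beliefPoint] <;> linarith

lemma beliefPoint_inr (d : G.Dart) :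
    beliefPoint J h η (Sum.inr (undirected d)) =
      ∑ x : Bool, ∑ y : Bool, pairBelief J h η d x y * (spin x * spin y) := by
  rcases orient_undirected d with h1 | h1
  · simp only [beliefPoint, h1]
  · simp only [beliefPoint, h1]
    rw [Finset.sum_comm]
    refine Finset.sum_congr rfl fun x _ => Finset.sum_congr rfl fun y _ => ?_
    rw [pairBelief_symm, mul_comm (spin x)]

namespace IsLBPFixedPoint

variable (hfix : IsLBPFixedPoint J h η)
include hfix

lemma updatedMessage_eq (d : G.Dart) (y : Bool) :
    updatedMessage J h η d y = message η d y * updatedMessage J h η d false := by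
  cases y
  · simp [message]
  · have h1 : updatedMessage J h η d true / updatedMessage J h η d false = η d :=
      congrFun hfix.2 d
    rw [div_eq_iff (updatedMessage_pos hfix.1 d false).ne'] at h1
    simpa [message] using h1

/-- Local consistency. Summing out the tail produces the updated message, which at a fixed point is
proportional to the old one and completes the cavity product to the full vertex product. -/
lemma sum_pairWeight (d : G.Dart) (y : Bool) :
    ∑ x : Bool, pairWeight J h η d x y
      = updatedMessage J h η d false * vertexWeight h η d.snd y := by
  have h1 : ∑ x : Bool, pairWeight J h η d x y
      = updatedMessage J h η d y * cavity h η d.symm y := by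
    rw [updatedMessage, Finset.sum_mul]
    rfl
  have h2 := vertexWeight_fst (h := h) (η := η) d.symm y
  rw [dart_symm_fst, SimpleGraph.Dart.symm_symm] at h2
  rw [h1, hfix.updatedMessage_eq, h2]
  ring

lemma sum_pairBelief_left (d : G.Dart) (y : Bool) :
    ∑ x : Bool, pairBelief J h η d x y = vertexBelief h η d.snd y := by
  simp only [pairBelief]
  rw [← Finset.sum_div, hfix.sum_pairWeight, Finset.sum_comm]
  simp only [hfix.sum_pairWeight]
  rw [← Finset.mul_sum, mul_div_mul_left _ _ (updatedMessage_pos hfix.1 d false).ne']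
  rfl

lemma sum_pairBelief_right (d : G.Dart) (x : Bool) :
    ∑ y : Bool, pairBelief J h η d x y = vertexBelief h η d.fst x := by
  have h1 := hfix.sum_pairBelief_left d.symm x
  simpa only [pairBelief_symm, dart_symm_snd] using h1

end IsLBPFixedPoint

/-- The form `1 + m_i x_i + m_j x_j + χ_ij x_i x_j` for the dart `i → j`. -/
noncomputable def dartForm (q : V ⊕ G.edgeSet → ℝ) (d : G.Dart) (x y : Bool) : ℝ :=
  1 + q (Sum.inl d.fst) * spin x + q (Sum.inl d.snd) * spin y
    + q (Sum.inr (undirected d)) * (spin x * spin y)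

omit [Fintype V] [DecidableEq V] [DecidableRel G.Adj] in
lemma edgeForm_eq_dartForm (q : V ⊕ G.edgeSet → ℝ) (e : G.edgeSet) (x y : Bool) :
    edgeForm q e x y = dartForm q (orient G e) x y := by
  simp only [edgeForm, dartForm, undirected_orient]

/-- A distribution on two spins is determined by its two means and its correlation; consistency
ensures that the vertex means are those of the pair belief. -/
lemma IsLBPFixedPoint.dartForm_beliefPoint (hfix : IsLBPFixedPoint J h η) (d : G.Dart)
    (x y : Bool) : dartForm (beliefPoint J h η) d x y = 4 * pairBelief J h η d x y := by
  have hl := hfix.sum_pairBelief_left d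
  have hr := hfix.sum_pairBelief_right d
  have hone := vertexBelief_add (h := h) hfix.1 d.fst
  have h1 := one_add_beliefPoint_inl (J := J) (h := h) hfix.1 d.fst true
  have h2 := one_add_beliefPoint_inl (J := J) (h := h) hfix.1 d.snd true
  rw [← hr, ← hr] at hone
  rw [← hr] at h1
  rw [← hl] at h2
  simp only [Fintype.sum_bool, spin_true, mul_one] at hone h1 h2
  have h1' := eq_sub_of_add_eq' h1
  have h2' := eq_sub_of_add_eq' h2
  rw [dartForm, beliefPoint_inr, h1', h2']
  cases x <;> cases y <;> simp <;> linarith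

/-- The variance of `x_i`. -/
def variance (q : V ⊕ G.edgeSet → ℝ) (i : V) : ℝ := 1 - q (Sum.inl i) ^ 2

/-- The covariance of `x_i` and `x_j`. -/
def covariance (q : V ⊕ G.edgeSet → ℝ) (d : G.Dart) : ℝ :=
  q (Sum.inr (undirected d)) - q (Sum.inl d.fst) * q (Sum.inl d.snd)

/-- Strictly positive pseudo-marginals with nonnegative covariances. -/
structure IsAttractivePoint (q : V ⊕ G.edgeSet → ℝ) : Prop where
  dartForm_pos : ∀ d x y, 0 < dartForm q d x y
  vertexForm_pos : ∀ i x, 0 < 1 + q (Sum.inl i) * spin x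
  covariance_nonneg : ∀ d, 0 ≤ covariance q d

omit [Fintype V] [DecidableEq V] [DecidableRel G.Adj] in
lemma covariance_eq (q : V ⊕ G.edgeSet → ℝ) (d : G.Dart) :
    4 * covariance q d = dartForm q d true true * dartForm q d false false
      - dartForm q d true false * dartForm q d false true := by
  simp only [covariance, dartForm, spin_true, spin_false]
  ring

omit [Fintype V] [DecidableEq V] [DecidableRel G.Adj] in
-- A sum of products of the four joint probabilities with positive coefficients, which makes the
-- Cauchy–Schwarz inequality for the covariance strict.
lemma gap_eq (q : V ⊕ G.edgeSet → ℝ) (d : G.Dart) :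
    4 * gap (variance q) (covariance q) d =
      dartForm q d true true * dartForm q d false false *
          (dartForm q d true false + dartForm q d false true)
      + dartForm q d true false * dartForm q d false true *
          (dartForm q d true true + dartForm q d false false) := by
  simp only [gap, variance, covariance, dartForm, spin_true, spin_false]
  ring

omit [Fintype V] [DecidableEq V] [DecidableRel G.Adj] in
lemma IsAttractivePoint.isCovariance {q : V ⊕ G.edgeSet → ℝ} (hq : IsAttractivePoint q) :
    IsCovariance (variance q) (covariance q) where
  var_pos i := by
    have h1 := mul_pos (hq.vertexForm_pos i true) (hq.vertexForm_pos i false)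
    simp only [spin_true, spin_false] at h1
    rw [variance]
    linarith
  nonneg := hq.covariance_nonneg
  symm d := by
    simp only [covariance, undirected_symm, dart_symm_fst, dart_symm_snd]
    ring
  sq_lt d := by
    have h1 := gap_eq q d
    have h2 := hq.dartForm_pos d true true
    have h3 := hq.dartForm_pos d true false
    have h4 := hq.dartForm_pos d false true
    have h5 := hq.dartForm_pos d false false
    have h6 : 0 < 4 * gap (variance q) (covariance q) d := by
      rw [h1]
      positivity
    have h7 : 0 < gap (variance q) (covariance q) d := by linarith
    exact sub_pos.1 h7

omit [Fintype V] [DecidableEq V] [DecidableRel G.Adj] in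
lemma psiPair_self (d : G.Dart) (x : Bool) : psiPair J d x x = Real.exp (J (undirected d)) := by
  cases x <;> simp [psiPair]

omit [Fintype V] [DecidableEq V] [DecidableRel G.Adj] in
lemma psiPair_true_false (d : G.Dart) :
    psiPair J d true false = Real.exp (-J (undirected d)) := by
  simp [psiPair]

omit [Fintype V] [DecidableEq V] [DecidableRel G.Adj] in
lemma psiPair_false_true (d : G.Dart) :
    psiPair J d false true = Real.exp (-J (undirected d)) := by
  simp [psiPair]

namespace IsLBPFixedPoint

variable (hfix : IsLBPFixedPoint J h η)
include hfix

/-- In `p₊₊ p₋₋ - p₊₋ p₋₊` both products contain the same four cavity factors, so the sign of the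
covariance is that of the coupling. -/
lemma covariance_beliefPoint (d : G.Dart) :
    covariance (beliefPoint J h η) d = 4 * ((cavity h η d true * cavity h η d false *
      cavity h η d.symm true * cavity h η d.symm false) *
      (Real.exp (J (undirected d)) ^ 2 - Real.exp (-J (undirected d)) ^ 2)
      / (∑ x : Bool, ∑ y : Bool, pairWeight J h η d x y) ^ 2) := by
  have h1 := covariance_eq (beliefPoint J h η) d
  simp only [hfix.dartForm_beliefPoint, pairBelief] at h1
  have h2 : covariance (beliefPoint J h η) d = 4 * ((pairWeight J h η d true true *
      pairWeight J h η d false false - pairWeight J h η d true false * pairWeight J h η d false true)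
      / (∑ x : Bool, ∑ y : Bool, pairWeight J h η d x y) ^ 2) := by
    rw [sub_div]
    simp only [pow_two, mul_div_mul_comm]
    linarith
  rw [h2]
  congr 2
  simp only [pairWeight, psiPair_self, psiPair_true_false, psiPair_false_true]
  ring

lemma isAttractivePoint (hJ : ∀ e, 0 ≤ J e) : IsAttractivePoint (beliefPoint J h η) where
  dartForm_pos d x y := by
    rw [hfix.dartForm_beliefPoint]
    exact mul_pos (by norm_num) (pairBelief_pos hfix.1 _ _ _)
  vertexForm_pos i x := by
    rw [one_add_beliefPoint_inl hfix.1]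
    exact mul_pos (by norm_num) (vertexBelief_pos hfix.1 _ _)
  covariance_nonneg d := by
    rw [hfix.covariance_beliefPoint]
    have h1 := cavity_pos (h := h) hfix.1
    have h2 : Real.exp (-J (undirected d)) ^ 2 ≤ Real.exp (J (undirected d)) ^ 2 :=
      pow_le_pow_left₀ (Real.exp_pos _).le (Real.exp_le_exp.2 (by linarith [hJ (undirected d)])) 2
    refine mul_nonneg (by norm_num) (div_nonneg (mul_nonneg ?_ (sub_nonneg.2 h2)) (sq_nonneg _))
    exact (mul_pos (mul_pos (mul_pos (h1 _ _) (h1 _ _)) (h1 _ _)) (h1 _ _)).le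

lemma covariance_pos (d : G.Dart) (hJ : 0 < J (undirected d)) :
    0 < covariance (beliefPoint J h η) d := by
  rw [hfix.covariance_beliefPoint]
  have h1 := cavity_pos (h := h) hfix.1
  have h2 : Real.exp (-J (undirected d)) ^ 2 < Real.exp (J (undirected d)) ^ 2 :=
    pow_lt_pow_left₀ (Real.exp_lt_exp.2 (by linarith)) (Real.exp_pos _).le (by norm_num)
  have h3 : 0 < ∑ x : Bool, ∑ y : Bool, pairWeight J h η d x y :=
    Finset.sum_pos (fun _ _ => Finset.sum_pos
      (fun _ _ => pairWeight_pos hfix.1 _ _ _) Finset.univ_nonempty) Finset.univ_nonempty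
  refine mul_pos (by norm_num) (div_pos (mul_pos ?_ (sub_pos.2 h2)) (by positivity))
  exact mul_pos (mul_pos (mul_pos (h1 _ _) (h1 _ _)) (h1 _ _)) (h1 _ _)

/-- The right-hand side is the logarithmic derivative of the update with respect to the logarithm of
any preceding message ratio, in the form found in `hasFDerivAt_lbp`. -/
lemma covariance_div_variance (d : G.Dart) :
    covariance (beliefPoint J h η) d / variance (beliefPoint J h η) d.snd =
      cavity h η d true * (Real.exp (J (undirected d)) / updatedMessage J h η d true
        - Real.exp (-J (undirected d)) / updatedMessage J h η d false) := by
  set Z := ∑ x : Bool, ∑ y : Bool, pairWeight J h η d x y with hZ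
  have hZpos : 0 < Z :=
    Finset.sum_pos (fun _ _ => Finset.sum_pos
      (fun _ _ => pairWeight_pos hfix.1 _ _ _) Finset.univ_nonempty) Finset.univ_nonempty
  have hb : ∀ y, vertexBelief h η d.snd y
      = updatedMessage J h η d y * cavity h η d.symm y / Z := by
    intro y
    rw [← hfix.sum_pairBelief_left, updatedMessage, Finset.sum_mul, Finset.sum_div]
    rfl
  have hv : variance (beliefPoint J h η) d.snd = 4 *
      (updatedMessage J h η d true * cavity h η d.symm true / Z) *
      (updatedMessage J h η d false * cavity h η d.symm false / Z) := by
    rw [← hb, ← hb, variance]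
    have h1 := one_add_beliefPoint_inl (J := J) (h := h) hfix.1 d.snd true
    have h2 := one_add_beliefPoint_inl (J := J) (h := h) hfix.1 d.snd false
    simp only [spin_true, spin_false] at h1 h2
    have h3 : 4 * vertexBelief h η d.snd true * vertexBelief h η d.snd false =
        (2 * vertexBelief h η d.snd true) * (2 * vertexBelief h η d.snd false) := by ring
    rw [h3, ← h1, ← h2]
    ring
  rw [hfix.covariance_beliefPoint, hv, ← hZ]
  have hA := cavity_pos (h := h) hfix.1 d true
  have hA' := cavity_pos (h := h) hfix.1 d.symm true
  have hB' := cavity_pos (h := h) hfix.1 d.symm false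
  have hUt := updatedMessage_pos (J := J) (h := h) hfix.1 d true
  have hUf := updatedMessage_pos (J := J) (h := h) hfix.1 d false
  have eUt : updatedMessage J h η d true = Real.exp (J (undirected d)) * cavity h η d true
      + Real.exp (-J (undirected d)) * cavity h η d false := by
    rw [updatedMessage, Fintype.sum_bool, psiPair_self, psiPair_false_true]
  have eUf : updatedMessage J h η d false = Real.exp (-J (undirected d)) * cavity h η d true
      + Real.exp (J (undirected d)) * cavity h η d false := by
    rw [updatedMessage, Fintype.sum_bool, psiPair_self, psiPair_true_false]
  field_simp
  rw [eUt, eUf]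
  ring

end IsLBPFixedPoint

end Beliefs

/-! ### The derivative of the update. -/

section Linearization

open Matrix

variable {V : Type*} [Fintype V] [DecidableEq V] {G : SimpleGraph V} [DecidableRel G.Adj]
  {J : G.edgeSet → ℝ} {h : V → ℝ} {η : G.Dart → ℝ}

lemma hasFDerivAt_cavity_true (hη : ∀ e, 0 < η e) (d : G.Dart) :
    HasFDerivAt (fun η => cavity h η d true)
      (cavity h η d true • ∑ c ∈ preds d, (η c)⁻¹ •
        (ContinuousLinearMap.proj c : (G.Dart → ℝ) →L[ℝ] ℝ)) η := by
  have h1 : HasFDerivAt (fun η : G.Dart → ℝ => ∏ c ∈ preds d, η c)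
      (∑ c ∈ preds d, (∏ c' ∈ (preds d).erase c, η c') •
        (ContinuousLinearMap.proj c : (G.Dart → ℝ) →L[ℝ] ℝ)) η :=
    HasFDerivAt.finsetProd fun c _ =>
      (ContinuousLinearMap.proj c : (G.Dart → ℝ) →L[ℝ] ℝ).hasFDerivAt
  have h2 := h1.const_mul (psiVertex h d.fst true)
  have h3 : (fun η : G.Dart → ℝ => cavity h η d true)
      = fun η => psiVertex h d.fst true * ∏ c ∈ preds d, η c := by
    funext η
    rw [cavity_eq]
    simp [message]
  rw [h3]
  refine h2.congr_fderiv ?_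
  rw [Finset.smul_sum, Finset.smul_sum]
  refine Finset.sum_congr rfl fun c hc => ?_
  rw [smul_smul, smul_smul]
  congr 1
  rw [congrFun h3 η, ← Finset.mul_prod_erase _ _ hc]
  have := (hη c).ne'
  field_simp

lemma cavity_false (d : G.Dart) (η' : G.Dart → ℝ) :
    cavity h η' d false = psiVertex h d.fst false := by
  rw [cavity_eq]
  simp [message]

/-- Messages are normalized to `1` at `false`, so only the cavity at `true` varies, and the quotient
rule reduces to its logarithmic derivative. -/
lemma hasFDerivAt_lbp (hη : ∀ e, 0 < η e) (d : G.Dart) :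
    HasFDerivAt (fun η => lbp J h η d)
      ((lbp J h η d * (cavity h η d true *
        (Real.exp (J (undirected d)) / updatedMessage J h η d true
        - Real.exp (-J (undirected d)) / updatedMessage J h η d false))) •
        ∑ c ∈ preds d, (η c)⁻¹ • (ContinuousLinearMap.proj c : (G.Dart → ℝ) →L[ℝ] ℝ)) η := by
  have hc := hasFDerivAt_cavity_true (h := h) hη d
  set L := ∑ c ∈ preds d, (η c)⁻¹ • (ContinuousLinearMap.proj c : (G.Dart → ℝ) →L[ℝ] ℝ)
  have hU : ∀ y, HasFDerivAt (fun η => updatedMessage J h η d y)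
      ((psiPair J d true y * cavity h η d true) • L) η := by
    intro y
    have h1 := (hc.const_mul (psiPair J d true y)).add_const
      (psiPair J d false y * psiVertex h d.fst false)
    have h2 : (fun η => updatedMessage J h η d y) = fun η =>
        psiPair J d true y * cavity h η d true + psiPair J d false y * psiVertex h d.fst false := by
      funext η'
      rw [updatedMessage, Fintype.sum_bool, cavity_false]
    rw [h2]
    refine h1.congr_fderiv ?_
    rw [smul_smul]
  have hpt := updatedMessage_pos (J := J) (h := h) hη d true
  have hpf := updatedMessage_pos (J := J) (h := h) hη d false
  have hinv := (hasDerivAt_inv hpf.ne').comp_hasFDerivAt η (hU false)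
  have hdiv := (hU true).mul hinv
  have hlbp : (fun η => lbp J h η d) = (fun η => updatedMessage J h η d true) *
      (fun y => y⁻¹) ∘ fun η => updatedMessage J h η d false :=
    funext fun η' => div_eq_mul_inv _ _
  rw [hlbp]
  refine hdiv.congr_fderiv ?_
  rw [psiPair_self, psiPair_true_false, lbp]
  ext v
  simp
  field_simp
  ring

/-- At a fixed point, the linearization of the update is similar to the non-backtracking matrix
with weights `Cov(x_i, x_j) / Var(x_j)`. -/
lemma IsLBPFixedPoint.spectrum_lbpLinearization (hfix : IsLBPFixedPoint J h η) :
    spectrum ℂ (lbpLinearization J h η) =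
      spectrum ℂ ((nonBacktracking fun d : G.Dart => covariance (beliefPoint J h η) d /
        variance (beliefPoint J h η) d.snd).map Complex.ofReal) := by
  set u : G.Dart → ℝ := fun d => covariance (beliefPoint J h η) d /
        variance (beliefPoint J h η) d.snd with hu
  have hη0 : ∀ d, (η d : ℂ) ≠ 0 := fun d => Complex.ofReal_ne_zero.2 (hfix.1 d).ne'
  -- Conjugation by the diagonal of the ratios is the change of coordinates from `η` to `log η`.
  let D : (Matrix G.Dart G.Dart ℂ)ˣ :=
    ⟨diagonal fun d => (η d : ℂ), diagonal fun d => (η d : ℂ)⁻¹,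
      by rw [diagonal_mul_diagonal]; simp [hη0],
      by rw [diagonal_mul_diagonal]; simp [hη0]⟩
  have hder : HasFDerivAt (lbp J h) (ContinuousLinearMap.pi fun d => (η d * u d) •
      ∑ c ∈ preds d, (η c)⁻¹ • (ContinuousLinearMap.proj c : (G.Dart → ℝ) →L[ℝ] ℝ)) η := by
    rw [hasFDerivAt_pi']
    intro d
    have h1 := hasFDerivAt_lbp (J := J) (h := h) hfix.1 d
    rw [← hfix.covariance_div_variance, congrFun hfix.2 d] at h1
    exact h1
  have hlin : lbpLinearization J h η =
      (D : Matrix G.Dart G.Dart ℂ) * (nonBacktracking u).map Complex.ofReal *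
        (↑D⁻¹ : Matrix G.Dart G.Dart ℂ) := by
    ext d c
    change _ = (diagonal (fun d => (η d : ℂ)) * (nonBacktracking u).map Complex.ofReal *
      diagonal fun d => (η d : ℂ)⁻¹) d c
    rw [mul_diagonal, diagonal_mul, lbpLinearization, hder.fderiv]
    simp only [map_apply, LinearMap.toMatrix'_apply, nonBacktracking, of_apply]
    simp [Finset.sum_apply, Pi.single_apply]
    by_cases hc : c ∈ preds d <;> simp [hc]
  rw [hlin]
  exact spectrum.units_conjugate

end Linearization

end BetheLBP

namespace BetheLBP

/-! ### The Hessian of the Bethe free energy. -/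

section Bethe

open Matrix

variable {V : Type*} [Fintype V] [DecidableEq V] {G : SimpleGraph V} [DecidableRel G.Adj]
  {J : G.edgeSet → ℝ} {h : V → ℝ}

lemma sum_orient_add_symm (g : G.Dart → ℝ) :
    ∑ e : G.edgeSet, (g (orient G e) + g (orient G e).symm) = ∑ d : G.Dart, g d := by
  rw [← Finset.sum_fiberwise Finset.univ (fun d : G.Dart => undirected d) g]
  refine Finset.sum_congr rfl fun e _ => ?_
  have h1 : Finset.univ.filter (fun d : G.Dart => undirected d = e)
      = {orient G e, (orient G e).symm} := by
    ext d
    simp only [Finset.mem_filter, Finset.mem_univ, true_and, Finset.mem_insert,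
      Finset.mem_singleton]
    constructor
    · rintro rfl
      rcases orient_undirected d with h1 | h1 <;> rw [h1] <;> simp
    · rintro (rfl | rfl) <;> simp
  rw [h1, Finset.sum_pair (orient G e).symm_ne.symm]

/-- The dart-wise sum of a function of the tail, weighted by degrees. -/
lemma sum_dart_fst (g : V → ℝ) : ∑ d : G.Dart, g d.fst = ∑ i, (G.degree i : ℝ) * g i := by
  rw [← Finset.sum_fiberwise Finset.univ (fun d : G.Dart => d.fst) fun d => g d.fst]
  refine Finset.sum_congr rfl fun i _ => ?_
  rw [Finset.sum_congr rfl fun d hd => congrArg g (Finset.mem_filter.1 hd).2, Finset.sum_const,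
    nsmul_eq_mul, G.dart_fst_fiber_card_eq_degree]

/-- The linear part of the Bethe free energy. -/
noncomputable def betheLinear (J : G.edgeSet → ℝ) (h : V → ℝ) : (V ⊕ G.edgeSet → ℝ) →L[ℝ] ℝ :=
  -(∑ e : G.edgeSet, J e • ContinuousLinearMap.proj (Sum.inr e)) -
    ∑ i : V, h i • ContinuousLinearMap.proj (Sum.inl i)

/-- The index set of the entropy terms of the Bethe free energy. -/
abbrev BetheIndex (G : SimpleGraph V) := (G.edgeSet × Bool × Bool) ⊕ (V × Bool)

/-- The weights of the entropy terms. -/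
def betheWeight : BetheIndex G → ℝ
  | Sum.inl _ => 1
  | Sum.inr (i, _) => 1 - G.degree i

/-- The constants of the affine functionals in the entropy terms. -/
noncomputable def betheConst : BetheIndex G → ℝ
  | Sum.inl _ => 1 / 4
  | Sum.inr _ => 1 / 2

/-- The linear parts of the affine functionals in the entropy terms. -/
noncomputable def betheForm : BetheIndex G → (V ⊕ G.edgeSet → ℝ) →L[ℝ] ℝ
  | Sum.inl (e, x, y) => (1 / 4 : ℝ) •
      (spin x • ContinuousLinearMap.proj (Sum.inl (orient G e).fst) +
        spin y • ContinuousLinearMap.proj (Sum.inl (orient G e).snd) +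
        (spin x * spin y) • ContinuousLinearMap.proj (Sum.inr e))
  | Sum.inr (i, x) => (spin x / 2) • ContinuousLinearMap.proj (Sum.inl i)

omit [Fintype V] [DecidableEq V] [DecidableRel G.Adj] in
lemma betheConst_add_betheForm_inl (q : V ⊕ G.edgeSet → ℝ) (e : G.edgeSet) (x y : Bool) :
    betheConst (Sum.inl (e, x, y) : BetheIndex G) + betheForm (Sum.inl (e, x, y)) q
      = dartForm q (orient G e) x y / 4 := by
  rw [← edgeForm_eq_dartForm]
  simp [betheConst, betheForm, edgeForm]
  ring

omit [Fintype V] [DecidableEq V] [DecidableRel G.Adj] in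
lemma betheConst_add_betheForm_inr (q : V ⊕ G.edgeSet → ℝ) (i : V) (x : Bool) :
    betheConst (Sum.inr (i, x) : BetheIndex G) + betheForm (Sum.inr (i, x)) q
      = (1 + q (Sum.inl i) * spin x) / 2 := by
  simp [betheConst, betheForm]
  ring

omit [DecidableEq V] in
lemma sum_betheIndex (g : BetheIndex G → ℝ) :
    ∑ k, g k = ∑ e : G.edgeSet, ∑ x : Bool, ∑ y : Bool, g (Sum.inl (e, x, y)) +
      ∑ i : V, ∑ x : Bool, g (Sum.inr (i, x)) := by
  rw [Fintype.sum_sum_type, Fintype.sum_prod_type, Fintype.sum_prod_type]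
  congr 1
  exact Finset.sum_congr rfl fun e _ => Fintype.sum_prod_type _

omit [DecidableEq V] in
lemma betheFreeEnergy_eq_entropySum :
    betheFreeEnergy J h = entropySum (betheLinear J h) betheWeight betheConst betheForm := by
  funext q
  rw [entropySum, sum_betheIndex]
  simp only [betheConst_add_betheForm_inl, betheConst_add_betheForm_inr]
  simp only [betheFreeEnergy, betheWeight, one_mul, edgeForm_eq_dartForm, ← Finset.mul_sum]
  simp [betheLinear]
  ring

omit [Fintype V] [DecidableEq V] [DecidableRel G.Adj] in
lemma IsAttractivePoint.betheForm_pos {q : V ⊕ G.edgeSet → ℝ} (hq : IsAttractivePoint q)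
    (k : BetheIndex G) : 0 < betheConst k + betheForm k q := by
  rcases k with ⟨e, x, y⟩ | ⟨i, x⟩
  · rw [betheConst_add_betheForm_inl]
    exact div_pos (hq.dartForm_pos _ _ _) (by norm_num)
  · rw [betheConst_add_betheForm_inr]
    exact div_pos (hq.vertexForm_pos _ _) (by norm_num)

/-- The explicit form of the Hessian matrix of the Bethe free energy. -/
noncomputable def explicitHessian (q : V ⊕ G.edgeSet → ℝ) :
    Matrix (V ⊕ G.edgeSet) (V ⊕ G.edgeSet) ℝ :=
  Matrix.of fun a b => entropySumHess (betheWeight (G := G)) betheConst betheForm q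
    (Pi.single a 1) (Pi.single b 1)

lemma IsAttractivePoint.betheHessian_eq {q : V ⊕ G.edgeSet → ℝ} (hq : IsAttractivePoint q) :
    betheHessian J h q = explicitHessian q := by
  rw [betheHessian, betheFreeEnergy_eq_entropySum, fderiv_fderiv_entropySum hq.betheForm_pos]
  rfl

lemma isSymm_explicitHessian (q : V ⊕ G.edgeSet → ℝ) : (explicitHessian q).IsSymm := by
  ext a b
  exact entropySumHess_comm _ _

lemma dotProduct_explicitHessian (q u : V ⊕ G.edgeSet → ℝ) :
    u ⬝ᵥ explicitHessian q *ᵥ u =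
      entropySumHess (betheWeight (G := G)) betheConst betheForm q u u := by
  rw [dotProduct_mulVec_eq_sum]
  conv_rhs => rw [pi_eq_sum_univ' u]
  simp only [map_sum, map_smul, _root_.sum_apply, _root_.smul_apply, smul_eq_mul,
    Finset.mul_sum, explicitHessian, of_apply]
  rw [Finset.sum_comm]
  refine Finset.sum_congr rfl fun a _ => Finset.sum_congr rfl fun b _ => ?_
  rw [mul_comm (entropySumHess _ _ _ _ _ _), mul_assoc, mul_left_comm]

/-- With `p, q, r, s` the edge form at `++, +-, -+, --`, the square in the correlation variable `x`
is completed. What remains in `a, b` is `4` times the form of the inverse covariance matrix of the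
edge. -/
lemma edge_quadratic_identity {p q r s : ℝ} (hp : 0 < p) (hq : 0 < q) (hr : 0 < r) (hs : 0 < s)
    (a b x : ℝ) :
    (a + b + x) ^ 2 / p + (a - b - x) ^ 2 / q + (-a + b - x) ^ 2 / r + (-a - b + x) ^ 2 / s
      = (1 / p + 1 / q + 1 / r + 1 / s) *
        (x + ((a + b) / p - (a - b) / q + (a - b) / r - (a + b) / s) /
          (1 / p + 1 / q + 1 / r + 1 / s)) ^ 2
      + 4 * ((p + r) * (q + s) * a ^ 2 - 2 * (p * s - q * r) * (a * b)
          + (p + q) * (r + s) * b ^ 2) / (p * s * (q + r) + q * r * (p + s)) := by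
  have h1 : p * s * (q + r) + q * r * (p + s) ≠ 0 := by positivity
  have h2 : 1 / p + 1 / q + 1 / r + 1 / s =
      (p * s * (q + r) + q * r * (p + s)) / (p * q * r * s) := by
    field_simp
    ring
  rw [h2]
  field_simp
  ring

/-- The curvature of the Bethe free energy in the direction of the correlation of an edge. -/
noncomputable def curvature (q : V ⊕ G.edgeSet → ℝ) (d : G.Dart) : ℝ :=
  1 / dartForm q d true true + 1 / dartForm q d true false + 1 / dartForm q d false true
    + 1 / dartForm q d false false

/-- The response of the correlation of an edge to a change of the means. -/
noncomputable def response (q : V ⊕ G.edgeSet → ℝ) (f : V → ℝ) (d : G.Dart) : ℝ :=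
  ((f d.fst + f d.snd) / dartForm q d true true - (f d.fst - f d.snd) / dartForm q d true false
    + (f d.fst - f d.snd) / dartForm q d false true
    - (f d.fst + f d.snd) / dartForm q d false false) / curvature q d

omit [Fintype V] [DecidableEq V] [DecidableRel G.Adj] in
lemma IsAttractivePoint.curvature_pos {q : V ⊕ G.edgeSet → ℝ} (hq : IsAttractivePoint q)
    (d : G.Dart) : 0 < curvature q d := by
  have h1 := hq.dartForm_pos d true true
  have h2 := hq.dartForm_pos d true false
  have h3 := hq.dartForm_pos d false true
  have h4 := hq.dartForm_pos d false false
  rw [curvature]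
  positivity

/-- Completing the square in the correlations. -/
lemma IsAttractivePoint.dotProduct_explicitHessian {q : V ⊕ G.edgeSet → ℝ}
    (hq : IsAttractivePoint q) (u : V ⊕ G.edgeSet → ℝ) :
    u ⬝ᵥ explicitHessian q *ᵥ u =
      (u ∘ Sum.inl) ⬝ᵥ reducedHessian (variance q) (covariance q) *ᵥ (u ∘ Sum.inl) +
      ∑ e : G.edgeSet, curvature q (orient G e) / 4 *
        (u (Sum.inr e) + response q (u ∘ Sum.inl) (orient G e)) ^ 2 := by
  have hcov := hq.isCovariance
  set v := variance q with hv
  set c := covariance q with hc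
  -- The inverse covariance form of an edge is written as one summand per orientation, ready for
  -- `sum_orient_add_symm`.
  have hedge : ∀ e : G.edgeSet, ∑ x : Bool, ∑ y : Bool,
      betheWeight (Sum.inl (e, x, y) : BetheIndex G) /
        (betheConst (Sum.inl (e, x, y) : BetheIndex G) + betheForm (Sum.inl (e, x, y)) q) *
        (betheForm (Sum.inl (e, x, y)) u * betheForm (Sum.inl (e, x, y)) u) =
      curvature q (orient G e) / 4 *
        (u (Sum.inr e) + response q (u ∘ Sum.inl) (orient G e)) ^ 2 +
      ((v (orient G e).snd * u (Sum.inl (orient G e).fst) ^ 2 -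
        c (orient G e) * (u (Sum.inl (orient G e).fst) * u (Sum.inl (orient G e).snd)))
          / gap v c (orient G e) +
      (v (orient G e).symm.snd * u (Sum.inl (orient G e).symm.fst) ^ 2 -
        c (orient G e).symm *
          (u (Sum.inl (orient G e).symm.fst) * u (Sum.inl (orient G e).symm.snd)))
          / gap v c (orient G e).symm) := by
    intro e
    simp only [betheConst_add_betheForm_inl, betheWeight, hcov.gap_symm, hcov.symm,
      dart_symm_fst, dart_symm_snd]
    generalize hd : orient G e = d
    have h1 := hq.dartForm_pos d true true
    have h2 := hq.dartForm_pos d true false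
    have h3 := hq.dartForm_pos d false true
    have h4 := hq.dartForm_pos d false false
    have hid := edge_quadratic_identity h1 h2 h3 h4 (u (Sum.inl d.fst)) (u (Sum.inl d.snd))
      (u (Sum.inr e))
    have hv1 : 4 * v d.snd = (dartForm q d true true + dartForm q d false true) *
        (dartForm q d true false + dartForm q d false false) := by
      simp only [hv, variance, dartForm, spin_true, spin_false]
      ring
    have hv2 : 4 * v d.fst = (dartForm q d true true + dartForm q d true false) *
        (dartForm q d false true + dartForm q d false false) := by
      simp only [hv, variance, dartForm, spin_true, spin_false]
      ring
    have hg := gap_eq q d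
    rw [← hv, ← hc] at hg
    have hgpos := hcov.gap_pos d
    rw [show dartForm q d true true * dartForm q d false false *
        (dartForm q d true false + dartForm q d false true) +
        dartForm q d true false * dartForm q d false true *
        (dartForm q d true true + dartForm q d false false) = 4 * gap v c d from hg.symm,
      ← hv1, ← hv2, ← covariance_eq q d, ← hc] at hid
    have hfin : ∀ x y : Bool, 1 / (dartForm q d x y / 4) *
        (betheForm (Sum.inl (e, x, y)) u * betheForm (Sum.inl (e, x, y)) u) =
        (u (Sum.inl d.fst) * spin x + u (Sum.inl d.snd) * spin y +
          u (Sum.inr e) * (spin x * spin y)) ^ 2 / dartForm q d x y / 4 := by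
      intro x y
      have := hq.dartForm_pos d x y
      simp [betheForm, hd]
      field_simp
    simp only [hfin, Fintype.sum_bool, spin_true, spin_false]
    have hR : curvature q d * (u (Sum.inr e) + response q (u ∘ Sum.inl) d) ^ 2 +
        4 * ((v d.snd * u (Sum.inl d.fst) ^ 2 -
        c d * (u (Sum.inl d.fst) * u (Sum.inl d.snd))) / gap v c d +
        (v d.fst * u (Sum.inl d.snd) ^ 2 -
        c d * (u (Sum.inl d.snd) * u (Sum.inl d.fst))) / gap v c d) =
      (u (Sum.inl d.fst) + u (Sum.inl d.snd) + u (Sum.inr e)) ^ 2 / dartForm q d true true +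
      (u (Sum.inl d.fst) - u (Sum.inl d.snd) - u (Sum.inr e)) ^ 2 / dartForm q d true false +
      (-u (Sum.inl d.fst) + u (Sum.inl d.snd) - u (Sum.inr e)) ^ 2 / dartForm q d false true +
      (-u (Sum.inl d.fst) - u (Sum.inl d.snd) + u (Sum.inr e)) ^ 2 / dartForm q d false false := by
      rw [hid]
      simp only [curvature, response, Function.comp_apply]
      congr 1
      field_simp
      ring
    linear_combination -hR / 4
  have hvert : ∀ i : V, ∑ x : Bool,
      betheWeight (Sum.inr (i, x) : BetheIndex G) /
        (betheConst (Sum.inr (i, x) : BetheIndex G) + betheForm (Sum.inr (i, x)) q) *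
        (betheForm (Sum.inr (i, x)) u * betheForm (Sum.inr (i, x)) u) =
      u (Sum.inl i) ^ 2 / v i - G.degree i * (u (Sum.inl i) ^ 2 / v i) := by
    intro i
    have h1 := hq.vertexForm_pos i true
    have h2 := hq.vertexForm_pos i false
    simp only [betheConst_add_betheForm_inr, Fintype.sum_bool, betheWeight]
    simp only [spin_true, spin_false, mul_one, mul_neg, ← sub_eq_add_neg] at h1 h2
    have h3 : v i = (1 + q (Sum.inl i)) * (1 - q (Sum.inl i)) := by
      simp only [hv, variance]
      ring
    rw [h3]
    simp only [betheForm, spin_true, spin_false, _root_.smul_apply, smul_eq_mul,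
      ContinuousLinearMap.proj_apply, mul_one, mul_neg, ← sub_eq_add_neg]
    field_simp
    ring
  rw [BetheLBP.dotProduct_explicitHessian, entropySumHess_apply, sum_betheIndex,
    Finset.sum_congr rfl fun e _ => hedge e, Finset.sum_congr rfl fun i _ => hvert i,
    Finset.sum_add_distrib, sum_orient_add_symm fun d : G.Dart =>
      (v d.snd * u (Sum.inl d.fst) ^ 2 - c d * (u (Sum.inl d.fst) * u (Sum.inl d.snd)))
          / gap v c d,
    hcov.dotProduct_reducedHessian, Finset.sum_sub_distrib,
    ← sum_dart_fst (G := G) fun i => u (Sum.inl i) ^ 2 / v i]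
  -- The `-degree` part of the vertex terms is spread over the outgoing darts; there `v_j / gap - 1
  -- / v_i = c² / (v_i gap)` turns the edge term into the diagonal of `Y`.
  have hsum : ∑ d : G.Dart, c d / gap v c d * (c d * (u ∘ Sum.inl) d.fst ^ 2 / v d.fst -
      (u ∘ Sum.inl) d.fst * (u ∘ Sum.inl) d.snd) =
      ∑ d : G.Dart, (v d.snd * u (Sum.inl d.fst) ^ 2 -
        c d * (u (Sum.inl d.fst) * u (Sum.inl d.snd))) / gap v c d -
      ∑ d : G.Dart, u (Sum.inl d.fst) ^ 2 / v d.fst := by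
    rw [← Finset.sum_sub_distrib]
    refine Finset.sum_congr rfl fun d _ => ?_
    have h1 := hcov.gap_pos d
    have h2 := hcov.var_pos d.fst
    simp only [Function.comp_apply]
    field_simp
    rw [gap]
    ring
  rw [hsum]
  simp only [Function.comp_apply]
  ring

/-- Positive definiteness passes from the reduced Hessian to the Hessian. -/
lemma IsAttractivePoint.posDef_explicitHessian {q : V ⊕ G.edgeSet → ℝ}
    (hq : IsAttractivePoint q) (hY : (reducedHessian (variance q) (covariance q)).PosDef) :
    (explicitHessian q).PosDef := by
  refine posDef_of_isSymm (isSymm_explicitHessian q) fun u hu => ?_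
  rw [hq.dotProduct_explicitHessian]
  have hsq : ∀ e : G.edgeSet, 0 ≤ curvature q (orient G e) / 4 *
      (u (Sum.inr e) + response q (u ∘ Sum.inl) (orient G e)) ^ 2 := fun e =>
    mul_nonneg (div_nonneg (hq.curvature_pos _).le (by norm_num)) (sq_nonneg _)
  by_cases h0 : u ∘ Sum.inl = 0
  · obtain ⟨e, he⟩ : ∃ e : G.edgeSet, u (Sum.inr e) ≠ 0 := by
      by_contra! hall
      refine hu (funext fun a => ?_)
      rcases a with i | e
      exacts [congrFun h0 i, hall e]
    rw [h0, zero_dotProduct, zero_add]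
    refine Finset.sum_pos' (fun e _ => by simpa only [h0] using hsq e) ⟨e, Finset.mem_univ e, ?_⟩
    have h1 := hq.curvature_pos (orient G e)
    simp only [response, Pi.zero_apply, add_zero, sub_zero, zero_div]
    positivity
  · exact add_pos_of_pos_of_nonneg (PosDef.pos_of_ne_zero hY h0)
      (Finset.sum_nonneg fun e _ => hsq e)

/-- A vector on the vertices extends to a vector with the same quadratic form. -/
lemma IsAttractivePoint.exists_dotProduct_eq {q : V ⊕ G.edgeSet → ℝ}
    (hq : IsAttractivePoint q) (f : V → ℝ) : ∃ u : V ⊕ G.edgeSet → ℝ,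
      u ⬝ᵥ explicitHessian q *ᵥ u = f ⬝ᵥ reducedHessian (variance q) (covariance q) *ᵥ f := by
  -- The correlations minimizing the form for given means: every completed square vanishes.
  refine ⟨Sum.elim f fun e => - response q f (orient G e), ?_⟩
  rw [hq.dotProduct_explicitHessian]
  simp

lemma continuousAt_explicitHessian {q : ℝ → V ⊕ G.edgeSet → ℝ} {t : ℝ}
    (hq : IsAttractivePoint (q t)) (hcont : ContinuousAt q t) :
    ContinuousAt (fun s => explicitHessian (q s)) t := by
  refine continuousAt_pi.2 fun a => continuousAt_pi.2 fun b => ?_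
  simp only [explicitHessian, of_apply, entropySumHess_apply]
  refine tendsto_finsetSum _ fun k _ => ?_
  refine Tendsto.mul (Tendsto.div tendsto_const_nhds ?_ (hq.betheForm_pos k).ne')
    tendsto_const_nhds
  exact tendsto_const_nhds.add (((betheForm k).continuous.tendsto _).comp hcont)

end Bethe

end BetheLBP

namespace BetheLBP

/-! ### Fixed points are critical points. -/

section CriticalPoint

variable {V : Type*} [Fintype V] [DecidableEq V] {G : SimpleGraph V} [DecidableRel G.Adj]
  {J : G.edgeSet → ℝ} {h : V → ℝ} {η : G.Dart → ℝ}

/-- The log-ratio of the unnormalized belief of a vertex. -/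
noncomputable def vertexField (h : V → ℝ) (η : G.Dart → ℝ) (i : V) : ℝ :=
  2 * h i + ∑ c ∈ incoming G i, Real.log (η c)

omit [Fintype V] [DecidableEq V] in
lemma psiVertex_pos (h : V → ℝ) (i : V) (x : Bool) : 0 < psiVertex h i x := Real.exp_pos _

omit [Fintype V] [DecidableEq V] [DecidableRel G.Adj] in
lemma log_prod_message_true (hη : ∀ e, 0 < η e) (s : Finset G.Dart) :
    Real.log (∏ c ∈ s, message η c true) = ∑ c ∈ s, Real.log (η c) := by
  rw [Real.log_prod fun c _ => (message_pos hη c true).ne']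
  simp [message]

lemma log_vertexBelief_sub (hη : ∀ e, 0 < η e) (i : V) :
    Real.log (vertexBelief h η i true) - Real.log (vertexBelief h η i false)
      = vertexField h η i := by
  have hw := vertexWeight_pos (h := h) hη i
  have hZ : 0 < ∑ x : Bool, vertexWeight h η i x :=
    Finset.sum_pos (fun _ _ => hw _) Finset.univ_nonempty
  have h1 : ∀ x, vertexWeight h η i x
      = psiVertex h i x * ∏ c ∈ incoming G i, message η c x := fun x => rfl
  have hp : ∀ x, ∏ c ∈ incoming G i, message η c x ≠ 0 := fun x =>
    (Finset.prod_pos fun c _ => message_pos hη c x).ne'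
  rw [vertexBelief, vertexBelief, Real.log_div (hw _).ne' hZ.ne', Real.log_div (hw _).ne' hZ.ne',
    h1, h1, Real.log_mul (psiVertex_pos _ _ _).ne' (hp _), Real.log_mul (psiVertex_pos _ _ _).ne' (hp _),
    log_prod_message_true hη, psiVertex, psiVertex, Real.log_exp, Real.log_exp, vertexField]
  simp [message]
  ring

lemma log_cavity_sub (hη : ∀ e, 0 < η e) (d : G.Dart) :
    Real.log (cavity h η d true) - Real.log (cavity h η d false)
      = vertexField h η d.fst - Real.log (η d.symm) := by
  have hp : ∀ x, ∏ c ∈ preds d, message η c x ≠ 0 := fun x =>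
    (Finset.prod_pos fun c _ => message_pos hη c x).ne'
  rw [cavity_eq, cavity_eq, Real.log_mul (psiVertex_pos _ _ _).ne' (hp _),
    Real.log_mul (psiVertex_pos _ _ _).ne' (hp _),
    log_prod_message_true hη, psiVertex, psiVertex, Real.log_exp, Real.log_exp, vertexField,
    sum_incoming_fst]
  simp [message]
  ring

lemma log_pairBelief (hη : ∀ e, 0 < η e) (d : G.Dart) (x y : Bool) :
    Real.log (pairBelief J h η d x y) = J (undirected d) * spin x * spin y +
      Real.log (cavity h η d x) + Real.log (cavity h η d.symm y) -
      Real.log (∑ x' : Bool, ∑ y' : Bool, pairWeight J h η d x' y') := by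
  have hZ : 0 < ∑ x : Bool, ∑ y : Bool, pairWeight J h η d x y :=
    Finset.sum_pos (fun _ _ => Finset.sum_pos
      (fun _ _ => pairWeight_pos hη _ _ _) Finset.univ_nonempty) Finset.univ_nonempty
  have h1 := (cavity_pos (h := h) hη d x).ne'
  have h2 := (cavity_pos (h := h) hη d.symm y).ne'
  have h3 := (psiPair_pos (J := J) d x y).ne'
  rw [pairBelief, Real.log_div (pairWeight_pos hη _ _ _).ne' hZ.ne', pairWeight,
    Real.log_mul (mul_ne_zero h3 h1) h2, Real.log_mul h3 h1, psiPair, Real.log_exp]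

/-- Fixed points of loopy belief propagation are critical points of the Bethe free energy. -/
lemma IsLBPFixedPoint.entropySumGrad_eq_zero (hfix : IsLBPFixedPoint J h η) :
    entropySumGrad (betheLinear J h) betheWeight betheConst betheForm (beliefPoint J h η) = 0 := by
  ext1 u
  set p : V → ℝ := vertexField h η with hp
  have hexp : entropySumGrad (betheLinear J h) betheWeight betheConst betheForm
      (beliefPoint J h η) u =
      ∑ e : G.edgeSet, (-(J e * u (Sum.inr e)) + ∑ x : Bool, ∑ y : Bool,
        (Real.log (pairBelief J h η (orient G e) x y) + 1) *
          betheForm (Sum.inl (e, x, y) : BetheIndex G) u) +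
      ∑ i : V, (-(h i * u (Sum.inl i)) + (1 - (G.degree i : ℝ)) * ∑ x : Bool,
        (Real.log (vertexBelief h η i x) + 1) * betheForm (Sum.inr (i, x) : BetheIndex G) u) := by
    have h1 : ∀ a : ℝ, 4 * a / 4 = a := fun a => by ring
    have h2 : ∀ a : ℝ, 2 * a / 2 = a := fun a => by ring
    simp only [entropySumGrad, _root_.add_apply, _root_.sum_apply, _root_.smul_apply, smul_eq_mul]
    rw [sum_betheIndex]
    simp only [betheConst_add_betheForm_inl, betheConst_add_betheForm_inr,
      hfix.dartForm_beliefPoint, one_add_beliefPoint_inl hfix.1, h1, h2, betheWeight, one_mul,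
      mul_assoc, ← Finset.mul_sum]
    simp only [Finset.sum_add_distrib, Finset.sum_neg_distrib]
    simp [betheLinear]
    ring
  -- The `x y`-component of the log pair belief is `J e`, so the correlation direction cancels; its
  -- `x`-components are half the log-ratios of the two cavities.
  have hedge : ∀ e : G.edgeSet, -(J e * u (Sum.inr e)) + ∑ x : Bool, ∑ y : Bool,
        (Real.log (pairBelief J h η (orient G e) x y) + 1) *
          betheForm (Sum.inl (e, x, y) : BetheIndex G) u =
      u (Sum.inl (orient G e).fst) * (p (orient G e).fst - Real.log (η (orient G e).symm)) / 2 +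
      u (Sum.inl (orient G e).symm.fst) *
        (p (orient G e).symm.fst - Real.log (η (orient G e).symm.symm)) / 2 := by
    intro e
    rw [hp, ← log_cavity_sub hfix.1, ← log_cavity_sub hfix.1]
    simp only [log_pairBelief hfix.1, undirected_orient, betheForm, Fintype.sum_bool, spin_true,
      spin_false, _root_.smul_apply, _root_.add_apply, smul_eq_mul, ContinuousLinearMap.proj_apply,
      dart_symm_fst]
    ring
  have hvert : ∀ i : V, -(h i * u (Sum.inl i)) + (1 - (G.degree i : ℝ)) * ∑ x : Bool,
        (Real.log (vertexBelief h η i x) + 1) * betheForm (Sum.inr (i, x) : BetheIndex G) u =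
      -(h i * u (Sum.inl i)) + u (Sum.inl i) * p i / 2
        - (G.degree i : ℝ) * (u (Sum.inl i) * p i / 2) := by
    intro i
    rw [hp, ← log_vertexBelief_sub hfix.1]
    simp only [betheForm, Fintype.sum_bool, spin_true,
      spin_false, _root_.smul_apply, smul_eq_mul, ContinuousLinearMap.proj_apply]
    ring
  have hlog : ∑ d : G.Dart, u (Sum.inl d.fst) * Real.log (η d.symm) / 2 =
      ∑ i : V, u (Sum.inl i) * (∑ c ∈ incoming G i, Real.log (η c)) / 2 := by
    rw [← Finset.sum_fiberwise Finset.univ (fun d : G.Dart => d.fst)]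
    refine Finset.sum_congr rfl fun i _ => ?_
    rw [sum_incoming_eq_sum_outgoing, Finset.mul_sum, Finset.sum_div]
    refine Finset.sum_congr rfl fun d hd => ?_
    rw [(Finset.mem_filter.1 hd).2]
  have hsum : ∑ d : G.Dart, u (Sum.inl d.fst) * (p d.fst - Real.log (η d.symm)) / 2 =
      ∑ i, (G.degree i : ℝ) * (u (Sum.inl i) * p i / 2) -
      ∑ i : V, u (Sum.inl i) * (∑ c ∈ incoming G i, Real.log (η c)) / 2 := by
    rw [← sum_dart_fst (G := G) fun i => u (Sum.inl i) * p i / 2, ← hlog,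
      ← Finset.sum_sub_distrib]
    exact Finset.sum_congr rfl fun d _ => by ring
  rw [hexp, Finset.sum_congr rfl fun e _ => hedge e, Finset.sum_congr rfl fun i _ => hvert i,
    sum_orient_add_symm fun d : G.Dart =>
      u (Sum.inl d.fst) * (p d.fst - Real.log (η d.symm)) / 2, hsum, ← Finset.sum_sub_distrib,
    ← Finset.sum_add_distrib, _root_.zero_apply]
  -- The degree terms of edges and vertices have cancelled; half of the vertex field is `h i` plus
  -- half the incoming log-ratios, which cancels the rest.
  refine Finset.sum_eq_zero fun i _ => ?_
  rw [hp, vertexField]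
  ring

end CriticalPoint

/-! ### Continuity of the belief point in the parameter. -/

section Continuity

variable {V : Type*} [Fintype V] [DecidableEq V] {G : SimpleGraph V} [DecidableRel G.Adj]
  {J : ℝ → G.edgeSet → ℝ} {h : ℝ → V → ℝ} {η : ℝ → G.Dart → ℝ} {t : ℝ}

omit [Fintype V] [DecidableEq V] [DecidableRel G.Adj] in
lemma continuousAt_message (hη : ContinuousAt η t) (e : G.Dart) (x : Bool) :
    ContinuousAt (fun s => message (η s) e x) t := by
  cases x
  · simpa [message] using continuousAt_const
  · simpa [message] using continuousAt_pi.1 hη e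

omit [Fintype V] [DecidableEq V] in
lemma continuousAt_psiVertex (hh : ContinuousAt h t) (i : V) (x : Bool) :
    ContinuousAt (fun s => psiVertex (h s) i x) t :=
  Real.continuous_exp.continuousAt.comp ((continuousAt_pi.1 hh i).mul continuousAt_const)

lemma continuousAt_cavity (hh : ContinuousAt h t) (hη : ContinuousAt η t) (d : G.Dart)
    (x : Bool) : ContinuousAt (fun s => cavity (h s) (η s) d x) t :=
  (continuousAt_psiVertex hh _ _).mul
    (tendsto_finsetProd _ fun c _ => continuousAt_message hη c x)

lemma continuousAt_vertexWeight (hh : ContinuousAt h t) (hη : ContinuousAt η t) (i : V)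
    (x : Bool) : ContinuousAt (fun s => vertexWeight (h s) (η s) i x) t :=
  (continuousAt_psiVertex hh _ _).mul
    (tendsto_finsetProd _ fun c _ => continuousAt_message hη c x)

lemma continuousAt_pairWeight (hJ : ContinuousAt J t) (hh : ContinuousAt h t)
    (hη : ContinuousAt η t) (d : G.Dart) (x y : Bool) :
    ContinuousAt (fun s => pairWeight (J s) (h s) (η s) d x y) t := by
  refine ContinuousAt.mul (ContinuousAt.mul ?_ (continuousAt_cavity hh hη d x))
    (continuousAt_cavity hh hη d.symm y)
  exact Real.continuous_exp.continuousAt.comp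
    (((continuousAt_pi.1 hJ _).mul continuousAt_const).mul continuousAt_const)

lemma continuousAt_beliefPoint (hJ : ContinuousAt J t) (hh : ContinuousAt h t)
    (hη : ContinuousAt η t) (hpos : ∀ e, 0 < η t e) :
    ContinuousAt (fun s => beliefPoint (J s) (h s) (η s)) t := by
  refine continuousAt_pi.2 fun a => ?_
  rcases a with i | e
  · simp only [beliefPoint, vertexBelief]
    refine tendsto_finsetSum _ fun x _ => Tendsto.mul_const _ (Tendsto.div ?_ ?_ ?_)
    · exact continuousAt_vertexWeight hh hη i x
    · exact tendsto_finsetSum _ fun x _ => continuousAt_vertexWeight hh hη i x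
    · exact (Finset.sum_pos (fun _ _ => vertexWeight_pos hpos _ _) Finset.univ_nonempty).ne'
  · simp only [beliefPoint, pairBelief]
    refine tendsto_finsetSum _ fun x _ => tendsto_finsetSum _ fun y _ =>
      Tendsto.mul_const _ (Tendsto.div ?_ ?_ ?_)
    · exact continuousAt_pairWeight hJ hh hη _ x y
    · exact tendsto_finsetSum _ fun x _ => tendsto_finsetSum _ fun y _ =>
        continuousAt_pairWeight hJ hh hη _ x y
    · exact (Finset.sum_pos (fun _ _ => Finset.sum_pos
        (fun _ _ => pairWeight_pos hpos _ _ _) Finset.univ_nonempty) Finset.univ_nonempty).ne'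

end Continuity

/-! ### Stability of the fixed point versus the signature of the Hessian. -/

section Stability

open Matrix

variable {V : Type*} [Fintype V] [DecidableEq V] {G : SimpleGraph V} [DecidableRel G.Adj]
  {J : G.edgeSet → ℝ} {h : V → ℝ} {η : G.Dart → ℝ}

namespace IsLBPFixedPoint

variable (hfix : IsLBPFixedPoint J h η) (hJ : ∀ e, 0 ≤ J e)
include hfix hJ

lemma beliefPoint_mem_betheDomain : beliefPoint J h η ∈ betheDomain G := fun e x y => by
  rw [edgeForm_eq_dartForm]
  exact (hfix.isAttractivePoint hJ).dartForm_pos _ _ _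

lemma posDef_of_isStable (hs : IsStable J h η) :
    (explicitHessian (beliefPoint J h η)).PosDef := by
  have hq := hfix.isAttractivePoint hJ
  refine hq.posDef_explicitHessian (hq.isCovariance.posDef_of_spectrum ?_)
  rw [← hfix.spectrum_lbpLinearization]
  exact hs

/-- By contraposition: a nonnegative Hessian form restricts to a nonnegative form of `Y`, via the
extension of vertex vectors, and that confines the spectrum to the closed disc. -/
lemma exists_neg_of_isUnstable (hu : IsUnstable J h η) :
    ∃ u, u ⬝ᵥ explicitHessian (beliefPoint J h η) *ᵥ u < 0 := by
  have hq := hfix.isAttractivePoint hJ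
  obtain ⟨z, hz, hz1⟩ := hu
  rw [hfix.spectrum_lbpLinearization] at hz
  by_contra! hnn
  refine hz1.not_ge (hq.isCovariance.norm_le_one_of_mem_spectrum (fun f => ?_) hz)
  obtain ⟨u, hu⟩ := hq.exists_dotProduct_eq f
  exact hu ▸ hnn u

lemma isLocalMin_of_isStable (hs : IsStable J h η) :
    IsLocalMin (betheFreeEnergy J h) (beliefPoint J h η) := by
  have hq := hfix.isAttractivePoint hJ
  rw [betheFreeEnergy_eq_entropySum]
  refine isLocalMin_of_second_order_pos (eventually_hasFDerivAt_entropySum hq.betheForm_pos)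
    hfix.entropySumGrad_eq_zero (hasFDerivAt_entropySumGrad hq.betheForm_pos)
    entropySumHess_comm fun u hu => ?_
  rw [← dotProduct_explicitHessian]
  exact PosDef.pos_of_ne_zero (hfix.posDef_of_isStable hJ hs) hu

lemma isSaddlePoint_of_isUnstable (hu : IsUnstable J h η) :
    IsSaddlePoint (betheFreeEnergy J h) (beliefPoint J h η) := by
  have hq := hfix.isAttractivePoint hJ
  -- Without darts the matrix ring is trivial and the spectrum empty, which excludes instability. A
  -- dart is needed for its edge's correlation direction, where the form is always positive, ruling
  -- out a local maximum.
  have hdart : Nonempty G.Dart := by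
    by_contra hemp
    rw [not_nonempty_iff] at hemp
    obtain ⟨z, hz, -⟩ := hu
    rw [spectrum.of_subsingleton] at hz
    exact hz
  obtain ⟨d⟩ := hdart
  have hpos : 0 < (Pi.single (Sum.inr (undirected d)) 1 : V ⊕ G.edgeSet → ℝ) ⬝ᵥ
      explicitHessian (beliefPoint J h η) *ᵥ Pi.single (Sum.inr (undirected d)) 1 := by
    rw [hq.dotProduct_explicitHessian]
    have h0 : (Pi.single (Sum.inr (undirected d)) 1 : V ⊕ G.edgeSet → ℝ) ∘ Sum.inl = 0 := by
      funext i
      simp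
    rw [h0, zero_dotProduct, zero_add]
    refine Finset.sum_pos' (fun e _ => mul_nonneg (div_nonneg (hq.curvature_pos _).le
      (by norm_num)) (sq_nonneg _)) ⟨undirected d, Finset.mem_univ _, ?_⟩
    have h1 := hq.curvature_pos (orient G (undirected d))
    simp only [response, Pi.zero_apply, add_zero, sub_zero, zero_div, Pi.single_eq_same]
    positivity
  obtain ⟨u, hneg⟩ := hfix.exists_neg_of_isUnstable hJ hu
  rw [dotProduct_explicitHessian] at hpos hneg
  rw [betheFreeEnergy_eq_entropySum]
  have h1 := eventually_hasFDerivAt_entropySum (L := betheLinear J h) (w := betheWeight)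
    hq.betheForm_pos
  have h2 := hfix.entropySumGrad_eq_zero
  have h3 := hasFDerivAt_entropySumGrad (L := betheLinear J h) (w := betheWeight)
    hq.betheForm_pos
  have h4 := h1.self_of_nhds
  rw [h2] at h4
  refine ⟨h4,
    not_isLocalMin_of_second_order_neg h1 h2 h3 entropySumHess_comm hneg,
    not_isLocalMax_of_second_order_pos h1 h2 h3 entropySumHess_comm hpos⟩

/-- On a connected graph with positive couplings, a positive semidefinite Hessian becomes positive
definite after a rank-one perturbation at a vertex. -/
lemma posDef_add_vecMulVec (hG : G.Connected) (hJpos : ∀ e, 0 < J e)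
    (hH : ∀ u, 0 ≤ u ⬝ᵥ explicitHessian (beliefPoint J h η) *ᵥ u) (i : V) :
    (explicitHessian (beliefPoint J h η) + vecMulVec (Pi.single (Sum.inl i) 1)
      (Pi.single (Sum.inl i) 1)).PosDef := by
  have hq := hfix.isAttractivePoint hJ
  have hY : ∀ f, 0 ≤ f ⬝ᵥ reducedHessian (variance (beliefPoint J h η))
      (covariance (beliefPoint J h η)) *ᵥ f := fun f => by
    obtain ⟨u, hu⟩ := hq.exists_dotProduct_eq f
    exact hu ▸ hH u
  refine posDef_of_isSymm ((isSymm_explicitHessian _).add ?_) fun u hu => ?_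
  · ext a b
    simp [vecMulVec_apply, mul_comm]
  have h1 : u ⬝ᵥ (explicitHessian (beliefPoint J h η) + vecMulVec (Pi.single (Sum.inl i) 1)
      (Pi.single (Sum.inl i) 1)) *ᵥ u =
      u ⬝ᵥ explicitHessian (beliefPoint J h η) *ᵥ u + u (Sum.inl i) ^ 2 := by
    rw [add_mulVec, dotProduct_add, vecMulVec_mulVec]
    simp [pow_two]
  rw [h1]
  refine lt_of_le_of_ne (add_nonneg (hH u) (sq_nonneg _)) fun h0 => hu ?_
  have h2 : u ⬝ᵥ explicitHessian (beliefPoint J h η) *ᵥ u = 0 := by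
    linarith [hH u, sq_nonneg (u (Sum.inl i))]
  have h3 : u (Sum.inl i) = 0 := by
    rw [h2, zero_add] at h0
    exact pow_eq_zero_iff two_ne_zero |>.1 h0.symm
  rw [hq.dotProduct_explicitHessian] at h2
  have hsq : ∀ e : G.edgeSet, 0 ≤ curvature (beliefPoint J h η) (orient G e) / 4 *
      (u (Sum.inr e) + response (beliefPoint J h η) (u ∘ Sum.inl) (orient G e)) ^ 2 := fun e =>
    mul_nonneg (div_nonneg (hq.curvature_pos _).le (by norm_num)) (sq_nonneg _)
  have h4 := Finset.sum_nonneg fun e (_ : e ∈ Finset.univ) => hsq e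
  -- Both nonnegative parts of the Hessian form vanish; the vertex part is then in the kernel of `Y`
  -- and is zero at `i`.
  have h5 : u ∘ Sum.inl = 0 := by
    refine hq.isCovariance.eq_zero_of_dotProduct_eq_zero hG
      (fun d => hfix.covariance_pos d (hJpos _)) hY ?_ (i := i) h3
    linarith [hY (u ∘ Sum.inl)]
  rw [h5, zero_dotProduct, zero_add, Finset.sum_eq_zero_iff_of_nonneg
    (fun e _ => by simpa only [h5] using hsq e)] at h2
  funext a
  rcases a with j | e
  · exact congrFun h5 j
  · have h6 := h2 e (Finset.mem_univ e)
    have h7 := hq.curvature_pos (orient G e)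
    simpa [response, h7.ne'] using h6

end IsLBPFixedPoint

end Stability

end BetheLBP

/-! ### The bifurcation at `t₀`. -/

theorem theorem5 {V : Type*} [Fintype V] [DecidableEq V] (G : SimpleGraph V)
    [DecidableRel G.Adj] (hG : G.Connected)
    (a t₀ b : ℝ) (ha : a < t₀) (hb : t₀ < b)
    (J : ℝ → G.edgeSet → ℝ) (h : ℝ → V → ℝ)
    (hJcont : ContinuousOn J (Ioo a b)) (hhcont : ContinuousOn h (Ioo a b))
    (hattractive : ∀ t ∈ Ioo a b, ∀ e, 0 ≤ J t e)
    (η : ℝ → G.Dart → ℝ) (hηcont : ContinuousOn η (Ioo a b))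
    (hfixed : ∀ t ∈ Ioo a b, BetheLBP.IsLBPFixedPoint (J t) (h t) (η t))
    (hstable : ∀ t ∈ Ioo a t₀, BetheLBP.IsStable (J t) (h t) (η t))
    (hunstable : ∀ t ∈ Ioo t₀ b, BetheLBP.IsUnstable (J t) (h t) (η t)) :
    (∀ t ∈ Ioo a b, BetheLBP.beliefPoint (J t) (h t) (η t) ∈ BetheLBP.betheDomain G) ∧
    (∀ t ∈ Ioo a t₀,
      IsLocalMin (BetheLBP.betheFreeEnergy (J t) (h t))
        (BetheLBP.beliefPoint (J t) (h t) (η t)) ∧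
      0 < (BetheLBP.betheHessian (J t) (h t) (BetheLBP.beliefPoint (J t) (h t) (η t))).det) ∧
    (∀ t ∈ Ioo t₀ b,
      BetheLBP.IsSaddlePoint (BetheLBP.betheFreeEnergy (J t) (h t))
        (BetheLBP.beliefPoint (J t) (h t) (η t))) ∧
    ((∀ e, 0 < J t₀ e) → ∀ᶠ t in 𝓝[>] t₀,
      (BetheLBP.betheHessian (J t) (h t) (BetheLBP.beliefPoint (J t) (h t) (η t))).det < 0) := by
  have hl : ∀ t ∈ Ioo a t₀, t ∈ Ioo a b := fun t ht => ⟨ht.1, ht.2.trans hb⟩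
  have hr : ∀ t ∈ Ioo t₀ b, t ∈ Ioo a b := fun t ht => ⟨ha.trans ht.1, ht.2⟩
  have hq : ∀ t ∈ Ioo a b, BetheLBP.IsAttractivePoint
      (BetheLBP.beliefPoint (J t) (h t) (η t)) := fun t ht =>
    (hfixed t ht).isAttractivePoint (hattractive t ht)
  refine ⟨fun t ht => (hfixed t ht).beliefPoint_mem_betheDomain (hattractive t ht),
    fun t ht => ⟨(hfixed t (hl t ht)).isLocalMin_of_isStable (hattractive t (hl t ht))
      (hstable t ht), ?_⟩,
    fun t ht => (hfixed t (hr t ht)).isSaddlePoint_of_isUnstable (hattractive t (hr t ht))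
      (hunstable t ht), fun hJpos => ?_⟩
  · rw [(hq t (hl t ht)).betheHessian_eq]
    exact ((hfixed t (hl t ht)).posDef_of_isStable (hattractive t (hl t ht))
      (hstable t ht)).det_pos
  have ht₀ : t₀ ∈ Ioo a b := ⟨ha, hb⟩
  have hnhds : Ioo a b ∈ 𝓝 t₀ := Ioo_mem_nhds ha hb
  have hqcont : ContinuousAt (fun t => BetheLBP.beliefPoint (J t) (h t) (η t)) t₀ :=
    BetheLBP.continuousAt_beliefPoint (hJcont.continuousAt hnhds) (hhcont.continuousAt hnhds)
      (hηcont.continuousAt hnhds) (hfixed t₀ ht₀).1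
  have hHcont := BetheLBP.continuousAt_explicitHessian (hq t₀ ht₀) hqcont
  -- No stability is assumed at `t₀` itself; semidefiniteness there is the limit of positive
  -- definiteness from the left.
  have hpsd : ∀ u, 0 ≤ u ⬝ᵥ Matrix.mulVec (BetheLBP.explicitHessian
      (BetheLBP.beliefPoint (J t₀) (h t₀) (η t₀))) u := by
    intro u
    have hcont : Continuous fun A : Matrix (V ⊕ G.edgeSet) (V ⊕ G.edgeSet) ℝ =>
        u ⬝ᵥ Matrix.mulVec A u := by fun_prop
    have hlim := ((hcont.tendsto _).comp hHcont).mono_left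
      (nhdsWithin_le_nhds (s := Iio t₀))
    refine ge_of_tendsto hlim ?_
    filter_upwards [Ioo_mem_nhdsLT ha] with t ht
    rcases eq_or_ne u 0 with rfl | hu
    · simp
    · exact (BetheLBP.PosDef.pos_of_ne_zero ((hfixed t (hl t ht)).posDef_of_isStable
        (hattractive t (hl t ht)) (hstable t ht)) hu).le
  obtain ⟨i⟩ := hG.nonempty
  set E := Matrix.vecMulVec (Pi.single (Sum.inl i) 1 : V ⊕ G.edgeSet → ℝ)
    (Pi.single (Sum.inl i) 1 : V ⊕ G.edgeSet → ℝ) with hE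
  have hEsymm : E.IsSymm := by
    ext c d
    simp [hE, Matrix.vecMulVec_apply, mul_comm]
  -- Positivity of the couplings is used only at `t₀`: the perturbed Hessian is positive definite
  -- there, and this persists nearby by openness.
  have hev : ∀ᶠ t in 𝓝 t₀, (BetheLBP.explicitHessian
      (BetheLBP.beliefPoint (J t) (h t) (η t)) + E).PosDef :=
    BetheLBP.eventually_posDef (fun t => (BetheLBP.isSymm_explicitHessian _).add hEsymm)
      ((hfixed t₀ ht₀).posDef_add_vecMulVec (hattractive t₀ ht₀) hG hJpos hpsd i)
      (hHcont.tendsto.add_const E)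
  filter_upwards [nhdsWithin_le_nhds hev, Ioo_mem_nhdsGT hb] with t hP ht
  obtain ⟨u, hu⟩ := (hfixed t (hr t ht)).exists_neg_of_isUnstable (hattractive t (hr t ht))
    (hunstable t ht)
  rw [(hq t (hr t ht)).betheHessian_eq]
  exact BetheLBP.det_neg_of_posDef_add_vecMulVec hP hu
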